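/- Let $M=\langle S,\bar s,A,E,\Delta\rangle$ be a Markov decision process: $S$ and $A$ are finite, $\bar s\in S$ is the initial state, $E(s)\subseteq A$ is the non-empty set of actions enabled in $s$, and $\Delta(s,a)$ is a probability distribution on $S$ for $a\in E(s)$. Let $0\neq 1$ be two distinguished states that are terminal, i.e. $\Delta(s,a)(s)=1$ for $s\in\{0,1\}$ and $a\in E(s)$; the set of target states is $F=\{1\}$. Write $V(s)=\sup_\sigma \Pr^\sigma_{s}(\Diamond F)$ for the supremum, over all history-dependent randomised strategies, of the probability of reaching $F$ from $s$, and $V(s,a)=\sum_{s'}\Delta(s,a)(s')V(s')$ for $a\in E(s)$. An end component is a pair $(T,B)$ of a set $T$ of states and a non-empty set $B$ of state-action pairs $(s,a)$ with $s\in T$, $a\in E(s)$, such that $\Delta(s,a)(s')>0$ with $(s,a)\in B$ implies $s'\in T$, and any two states of $T$ are connected by a path that uses only pairs of $B$. For $W:S\times A\to[0,1]$ put $W(s)=\max_{a\in E(s)}W(s,a)$. The algorithm BRTDP with precision $\varepsilon>0$ keeps bounds $U,L:S\times A\to[0,1]$, initially $U(0,\cdot)=0$ and $U(s,\cdot)=1$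 for $s\ne 0$, $L(1,\cdot)=1$ and $L(s,\cdot)=0$ for $s\neq 1$. It repeats the following iteration. (Explore) Starting with $\omega=\bar s$, repeat: draw $a$ uniformly from $\arg\max_{a\in E(s)}U(s,a)$, where $s$ is the last state of $\omega$, draw $s'$ from $\Delta(s,a)$, and append $a\,s'$ to $\omega$; until $s'\in\{0,1\}$. (Update) Repeat: remove the last action $a$ and the last state from $\omega$, let $s$ be the state in which $\omega$ now ends, and assign $U(s,a):=\sum_{s'}\Delta(s,a)(s')U(s')$ and $L(s,a):=\sum_{s'}\Delta(s,a)(s')L(s')$; until $\omega=\bar s$. The algorithm terminates at the end of the first iteration after which $U(\bar s)-L(\bar s)<\varepsilon$. Assume that every end component $(T,B)$ of $M$ has $T=\{0\}$ or $T=\{1\}$. Then: 1. (Almost sure convergence) For every $\varepsilon>0$, BRTDP with precision $\varepsilon$ almost surely terminates, with $U(\bar s)-L(\bar s)<\varepsilon$ and $L(\bar s,a)\le V(\bar s,a)\le U(\bar s,a)$ for all $a\in E(\bar s)$. 2. In every computation of the algorithm, whatever the stopping condition, for all $s\in S$ and $a\in E(s)$, $U(s,a)$ never increases, $L(s,a)$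 never decreases, and $L(s,a)\le V(s,a)\le U(s,a)$ holds at all times. 3. If the iteration is repeated forever, without the termination test, then almost surely every iteration is completed, and the bounds $U_i,L_i$ after $i$ iterations satisfy $U_i(s,a)\ge U_j(s,a)\ge V(s,a)\ge L_j(s,a)\ge L_i(s,a)$ for all $i\le j$, $s\in S$, $a\in E(s)$, and $\lim_{i\to\infty}\bigl(U_i(\bar s)-L_i(\bar s)\bigr)=0$. -/

import Mathlib

open MeasureTheory ProbabilityTheory Filter Topology

/-! ## Markov chains on a discrete state space -/

section MarkovChain

variable {X : Type*} [MeasurableSpace X] [DiscreteMeasurableSpace X]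

/-- The kernel on the histories `x 0, …, x n` that draws `x (n + 1)` from `step (x n)`. -/
noncomputable def chainKernel (step : X → PMF X) (n : ℕ) :
    Kernel ((i : Finset.Iic n) → (fun _ : ℕ => X) i) X where
  toFun h := (step (h ⟨n, Finset.mem_Iic.mpr le_rfl⟩)).toMeasure
  measurable' :=
    (Measurable.of_discrete (f := fun x : X => (step x).toMeasure)).comp (measurable_pi_apply _)

instance chainKernel_isMarkovKernel (step : X → PMF X) (n : ℕ) :
    IsMarkovKernel (chainKernel step n) :=
  ⟨fun h => inferInstanceAs
    (IsProbabilityMeasure (step (h ⟨n, Finset.mem_Iic.mpr le_rfl⟩)).toMeasure)⟩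

/-- The law, on infinite sequences, of the Markov chain that starts in `x₀` and moves from `x` to
a successor drawn from `step x`. -/
noncomputable def chainLaw (step : X → PMF X) (x₀ : X) : Measure (ℕ → X) :=
  Kernel.trajMeasure (X := fun _ : ℕ => X) (Measure.dirac x₀) (chainKernel step)

end MarkovChain

/-! ## Markov decision processes -/

/-- A Markov decision process with states `S` and actions `A`. Only the values `Δ s a` with
`a ∈ E s` matter; the other ones are irrelevant. -/
structure MDP (S A : Type*) where
  /-- the initial state -/
  init : S
  /-- the enabled actions -/
  E : S → Finset A
  E_nonempty : ∀ s, (E s).Nonempty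
  /-- the transition probabilities -/
  Δ : S → A → PMF S

/-- Finite sequences `s₀ a₀ s₁ a₁ … sₙ` of alternating states and actions. -/
inductive FinPath (S A : Type*) where
  | start (s : S) : FinPath S A
  | snoc (ω : FinPath S A) (a : A) (s : S) : FinPath S A

/-- The last state of a finite sequence. -/
def FinPath.last {S A : Type*} : FinPath S A → S
  | start s => s
  | snoc _ _ s => s

instance {S A : Type*} : MeasurableSpace (FinPath S A) := ⊤

instance {S A : Type*} : DiscreteMeasurableSpace (FinPath S A) := ⟨fun _ => trivial⟩

namespace MDP

variable {S A : Type*} (M : MDP S A)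

/-- A state is terminal if every enabled action returns to it with probability one. -/
def IsTerminal (s : S) : Prop := ∀ a ∈ M.E s, M.Δ s a s = 1

/-- `(T, B)` is an end component: `T` is a set of states and `B` a nonempty set of actions enabled
in states of `T`, each action being recorded with the state in which it is taken, such that actions
of `B` never leave `T` and any two states of `T` are connected by a path using only actions
of `B`. -/
def IsEndComponent (T : Set S) (B : Set (S × A)) : Prop :=
  B.Nonempty ∧
  (∀ p ∈ B, p.1 ∈ T ∧ p.2 ∈ M.E p.1) ∧
  (∀ p ∈ B, ∀ s', 0 < M.Δ p.1 p.2 s' → s' ∈ T) ∧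
  (∀ s ∈ T, ∀ s' ∈ T,
    Relation.ReflTransGen (fun x y => ∃ a, (x, a) ∈ B ∧ 0 < M.Δ x a y) s s')

/-- `zero` and `one` are distinct terminal states, and there are no end components besides the
trivial ones consisting of one of these two states. -/
structure OnlyTrivialECs (zero one : S) : Prop where
  ne : zero ≠ one
  terminal_zero : M.IsTerminal zero
  terminal_one : M.IsTerminal one
  trivial_of_ec : ∀ T B, M.IsEndComponent T B → T = {zero} ∨ T = {one}

/-- A (history-dependent, randomised) strategy. -/
structure Strategy where
  act : FinPath S A → PMF A
  enabled : ∀ ω, ∀ a ∈ (act ω).support, a ∈ M.E ω.last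

/-- One step under a strategy: extend `ω` by an action drawn from the strategy and a successor
state drawn from the transition probabilities. -/
noncomputable def strategyStep (σ : M.Strategy) (ω : FinPath S A) : PMF (FinPath S A) :=
  (σ.act ω).bind fun a => (M.Δ ω.last a).map fun s => ω.snoc a s

/-- The probability measure induced by a strategy and a state `s`; an infinite path is represented
by the sequence of its finite prefixes. -/
noncomputable def pathMeasure (σ : M.Strategy) (s : S) : Measure (ℕ → FinPath S A) :=
  chainLaw (M.strategyStep σ) (FinPath.start s)

/-- The probability of reaching the set `F` from `s` under the strategy `σ`. -/
noncomputable def reachProb (F : Set S) (σ : M.Strategy) (s : S) : ℝ :=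
  (M.pathMeasure σ s).real {ω | ∃ n, (ω n).last ∈ F}

/-- The value `V(s)`: the supremum over all strategies of the probability of reaching `F`. -/
noncomputable def stateValue (F : Set S) (s : S) : ℝ :=
  ⨆ σ : M.Strategy, M.reachProb F σ s

/-- The value `V(s, a) = ∑ s', Δ(s, a)(s') V(s')` of a state-action pair. -/
noncomputable def value [Fintype S] (F : Set S) (s : S) (a : A) : ℝ :=
  ∑ s', (M.Δ s a s').toReal * M.stateValue F s'

/-- The maximum of `W(s, a)` over the actions `a` enabled in `s`. -/
noncomputable def maxE (W : S → A → ℝ) (s : S) : ℝ :=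
  (M.E s).sup' (M.E_nonempty s) (W s)

open Classical in
/-- The enabled actions of `s` at which `W(s, ·)` is maximal. -/
noncomputable def argmaxE (W : S → A → ℝ) (s : S) : Finset A :=
  (M.E s).filter fun a => ∀ b ∈ M.E s, W s b ≤ W s a

theorem argmaxE_nonempty (W : S → A → ℝ) (s : S) : (M.argmaxE W s).Nonempty := by
  obtain ⟨a, ha, h⟩ := Finset.exists_max_image (M.E s) (W s) (M.E_nonempty s)
  exact ⟨a, by simp only [argmaxE, Finset.mem_filter]; exact ⟨ha, h⟩⟩

end MDP

/-! ## The algorithm BRTDP -/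

namespace BRTDP

/-- The phases of a computation. -/
inductive Phase where
  | explore
  | update
  | halted

/-- A configuration of the algorithm: the current phase, the path `ω`, the current bounds `U`, `L`,
and the number `iter` of completed iterations of the outer loop. -/
structure Config (S A : Type*) where
  phase : Phase
  path : FinPath S A
  U : S → A → ℝ
  L : S → A → ℝ
  iter : ℕ

instance {S A : Type*} : MeasurableSpace (Config S A) := ⊤

instance {S A : Type*} : DiscreteMeasurableSpace (Config S A) := ⟨fun _ => trivial⟩

variable {S A : Type*} [Fintype S] (M : MDP S A) (zero one : S)

open Classical in
/-- The initial configuration: `U = 1` except that `U(0, ·) = 0`, and `L = 0` except that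
`L(1, ·) = 1`. -/
noncomputable def initial : Config S A where
  phase := .explore
  path := .start M.init
  U s _ := if s = zero then 0 else 1
  L s _ := if s = one then 1 else 0
  iter := 0

open Classical in
/-- The assignment `W(s, a) := ∑ s', Δ(s, a)(s') · max_{b ∈ E(s')} W(s', b)`. -/
noncomputable def backup (W : S → A → ℝ) (s : S) (a : A) : S → A → ℝ :=
  fun t b => if t = s ∧ b = a then ∑ s', (M.Δ s a s').toReal * M.maxE W s' else W t b

open Classical in
/-- One step of the exploration: draw an action uniformly among those maximising `U` in the last
state of the path, draw a successor, and append both to the path. The exploration ends when the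
successor is one of the two terminal states. -/
noncomputable def exploreStep (c : Config S A) : PMF (Config S A) :=
  (PMF.uniformOfFinset (M.argmaxE c.U c.path.last) (M.argmaxE_nonempty c.U c.path.last)).bind
    fun a => (M.Δ c.path.last a).map fun s =>
      { c with
        phase := if s = one ∨ s = zero then .update else .explore
        path := c.path.snoc a s }

open Classical in
/-- One step of the update phase: remove the last action and state from the path and update the
bounds of the state-action pair that is now at its end. The phase ends when the path consists of
the initial state only; this completes an iteration of the outer loop, and the algorithm halts if
the stopping condition `quit U L` holds, and begins the next iteration otherwise. -/
noncomputable def updateStep (quit : (S → A → ℝ) → (S → A → ℝ) → Prop) (c : Config S A) :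
    Config S A :=
  match c.path with
  | .start _ => c
  | .snoc ω a _ =>
    let U' := backup M c.U ω.last a
    let L' := backup M c.L ω.last a
    match ω with
    | .start s =>
      { phase := if quit U' L' then .halted else .explore
        path := .start s
        U := U'
        L := L'
        iter := c.iter + 1 }
    | .snoc _ _ _ => { c with path := ω, U := U', L := L' }

/-- One step of the algorithm with stopping condition `quit`. -/
noncomputable def step (quit : (S → A → ℝ) → (S → A → ℝ) → Prop) (c : Config S A) :
    PMF (Config S A) :=
  match c.phase with
  | .explore => exploreStep M zero one c
  | .update => PMF.pure (updateStep M quit c)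
  | .halted => PMF.pure c

/-- The law of the computation of the algorithm with stopping condition `quit`. -/
noncomputable def law (quit : (S → A → ℝ) → (S → A → ℝ) → Prop) : Measure (ℕ → Config S A) :=
  chainLaw (step M zero one quit) (initial M zero one)

/-- A possible computation: it starts in the initial configuration, and each step has positive
probability. -/
def IsComputation (quit : (S → A → ℝ) → (S → A → ℝ) → Prop) (ρ : ℕ → Config S A) : Prop :=
  ρ 0 = initial M zero one ∧ ∀ n, ρ (n + 1) ∈ (step M zero one quit (ρ n)).support

/-- The stopping condition of precision `ε`:
`max_{a ∈ E(init)} U(init, a) - max_{a ∈ E(init)} L(init, a) < ε`. -/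
def precise (ε : ℝ) (U L : S → A → ℝ) : Prop := M.maxE U M.init - M.maxE L M.init < ε

/-- The stopping condition that never holds: the outer loop is iterated forever. -/
def never (_ _ : S → A → ℝ) : Prop := False

/-- The configuration of `ρ` right after the `i`-th iteration of the outer loop (the initial one
if `i = 0`); meaningful if the `i`-th iteration is ever completed. -/
noncomputable def afterIter (ρ : ℕ → Config S A) (i : ℕ) : Config S A :=
  ρ (sInf {n | (ρ n).iter = i})

end BRTDP

/-! ### Markov chains on discrete spaces: one-step law and almost sure support -/

section ChainFacts

open Preorder
open scoped ENNReal

variable {X : Type*} [MeasurableSpace X] [DiscreteMeasurableSpace X]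

/-! Correctness of the bounds is deterministic. `U` stays a supersolution and `L` a subsolution of
the optimality equations, and a backup preserves this while lowering `U` and raising `L`. A
supersolution dominates the value by Fatou's lemma applied along the paths of a strategy
(`reachProb_le_of_supersolution`). A subsolution lies below the value by a maximum principle
(`OnlyTrivialECs.nonpos_of_le_sum`), the place where end components matter: the set on which a
function attains a positive maximum would be closed under suitable actions, so it would contain an
end component, hence `zero` or `one`, where the function is nonpositive.

Randomness enters only through fairness (`chainLaw_fair`, `fair_ae`): almost surely, if an action is
taken infinitely often in a state, each of its possible successors then occurs infinitely often.
Everything else holds for each fair computation. An exploration cannot last forever, since the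
states visited infinitely often would be closed and avoid `zero` and `one`
(`Fair.frequently_update`). Hence iterations keep being completed, and every drawn pair is
eventually backed up (`Draws.exists_backup`).

For convergence (`Fair.tendsto_gap`), let `u` and `l` be the monotone limits of the bounds. In a
state visited infinitely often, some action `a` is drawn infinitely often. It maximises `u`, and
both limits satisfy the backup equation at it, so the gap between the maxima of `u` and `l` is at
most its average after `a`. The maximum principle on the visited states makes the gap at the initial
state nonpositive. Termination follows, since the gap eventually drops below the precision and later
iterations are completed. -/

instance chainLaw_isProbabilityMeasure (step : X → PMF X) (x₀ : X) :
    IsProbabilityMeasure (chainLaw step x₀) :=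
  inferInstanceAs (IsProbabilityMeasure
    (Kernel.trajMeasure (X := fun _ : ℕ => X) (Measure.dirac x₀) (chainKernel step)))

theorem chainLaw_zero (step : X → PMF X) (x₀ : X) : ∀ᵐ ρ ∂(chainLaw step x₀), ρ 0 = x₀ := by
  have h : (chainLaw step x₀).map (frestrictLe (π := fun _ : ℕ => X) 0) =
      (Measure.dirac x₀).map (MeasurableEquiv.piUnique (fun _ : Finset.Iic 0 => X)).symm := by
    rw [chainLaw, Kernel.trajMeasure, Measure.map_comp _ _ (by fun_prop),
      Kernel.traj_map_frestrictLe, Kernel.partialTraj_self, Measure.id_comp]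
  have h2 : (chainLaw step x₀).map (fun ρ => ρ 0) = Measure.dirac x₀ := by
    have : (fun ρ : ℕ → X => ρ 0) =
        (MeasurableEquiv.piUnique (fun _ : Finset.Iic 0 => X)) ∘
          (frestrictLe (π := fun _ : ℕ => X) 0) := by
      ext ρ; rfl
    rw [this, ← Measure.map_map (by fun_prop) (by fun_prop), h,
      Measure.map_map (by fun_prop) (by fun_prop)]
    simp
  have h3 : ∀ᵐ x ∂((chainLaw step x₀).map (fun ρ => ρ 0)), x = x₀ := by
    rw [h2, ae_dirac_iff (MeasurableSet.of_discrete)]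
  exact ae_of_ae_map (measurable_pi_apply 0).aemeasurable h3

/-- The Markov property: given the history up to time `n`, the next element is drawn from
`step (ρ n)`. -/
theorem lintegral_chainLaw_succ (step : X → PMF X) (x₀ : X) (n : ℕ)
    (z : ((i : Finset.Iic n) → (fun _ : ℕ => X) i) → ℝ≥0∞) (hz : Measurable z)
    (f : X → X → ℝ≥0∞) (hf : Measurable (Function.uncurry f)) :
    ∫⁻ ρ, z (frestrictLe n ρ) * f (ρ n) (ρ (n + 1)) ∂(chainLaw step x₀) =
      ∫⁻ ρ, z (frestrictLe n ρ) * ∫⁻ y, f (ρ n) y ∂(step (ρ n)).toMeasure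
        ∂(chainLaw step x₀) := by
  have key := Kernel.map_frestrictLe_trajMeasure_compProd_eq_map_trajMeasure
    (X := fun _ : ℕ => X) (κ := chainKernel step) (μ₀ := Measure.dirac x₀) (a := n)
  let last : ((i : Finset.Iic n) → (fun _ : ℕ => X) i) → X :=
    fun h => h ⟨n, Finset.mem_Iic.mpr le_rfl⟩
  have hlast : Measurable last := measurable_pi_apply _
  have hm : Measurable (fun p : ((i : Finset.Iic n) → (fun _ : ℕ => X) i) × X =>
      z p.1 * f (last p.1) p.2) := by
    refine (hz.comp measurable_fst).mul ?_
    exact hf.comp ((hlast.comp measurable_fst).prodMk measurable_snd)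
  have e := congrArg (fun ν => ∫⁻ p, z p.1 * f (last p.1) p.2 ∂ν) key
  rw [Measure.lintegral_compProd hm, lintegral_map hm (by fun_prop),
    lintegral_map hm.lintegral_kernel_prod_right' (by fun_prop)] at e
  refine Eq.trans e.symm ?_
  refine lintegral_congr fun ρ => ?_
  change ∫⁻ y, z (frestrictLe n ρ) * f (ρ n) y ∂(step (ρ n)).toMeasure = _
  rw [lintegral_const_mul _ (by fun_prop)]

theorem chainLaw_inter_succ (step : X → PMF X) (x₀ : X) (n : ℕ) (G H : Set X) :
    chainLaw step x₀ {ρ | ρ n ∈ G ∧ ρ (n + 1) ∈ H} =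
      ∫⁻ ρ in {ρ | ρ n ∈ G}, (step (ρ n)).toMeasure H ∂(chainLaw step x₀) := by
  classical
  have hG : MeasurableSet {ρ : ℕ → X | ρ n ∈ G} :=
    measurable_pi_apply n (MeasurableSet.of_discrete)
  have hH : MeasurableSet {ρ : ℕ → X | ρ (n + 1) ∈ H} :=
    measurable_pi_apply (n + 1) (MeasurableSet.of_discrete)
  have := lintegral_chainLaw_succ step x₀ n (fun _ => 1) measurable_const
    (fun x y => G.indicator 1 x * H.indicator 1 y) (by
      exact ((Measurable.of_discrete (f := G.indicator 1)).comp measurable_fst).mul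
        ((Measurable.of_discrete (f := H.indicator 1)).comp measurable_snd))
  simp only [one_mul] at this
  rw [← lintegral_indicator hG]
  rw [← setLIntegral_one, ← lintegral_indicator (by exact hG.inter hH)]
  convert this using 1
  · refine lintegral_congr fun ρ => ?_
    by_cases h1 : ρ n ∈ G <;> by_cases h2 : ρ (n + 1) ∈ H <;> simp [Set.indicator, h1, h2]
  · refine lintegral_congr fun ρ => ?_
    rw [lintegral_const_mul _ Measurable.of_discrete,
      lintegral_indicator_one (MeasurableSet.of_discrete)]
    by_cases h1 : ρ n ∈ G <;> simp [Set.indicator, h1]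

theorem chainLaw_ae_not_step (step : X → PMF X) (x₀ : X) (n : ℕ) {G H : Set X}
    (h : ∀ x ∈ G, Disjoint (step x).support H) :
    ∀ᵐ ρ ∂(chainLaw step x₀), ¬ (ρ n ∈ G ∧ ρ (n + 1) ∈ H) := by
  have e : chainLaw step x₀ {ρ | ρ n ∈ G ∧ ρ (n + 1) ∈ H} = 0 := by
    have hG : MeasurableSet {ρ : ℕ → X | ρ n ∈ G} :=
      measurable_pi_apply n (MeasurableSet.of_discrete)
    rw [chainLaw_inter_succ, setLIntegral_congr_fun (g := fun _ => 0) hG, lintegral_zero]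
    intro ρ hρ
    exact (PMF.toMeasure_apply_eq_zero_iff _ MeasurableSet.of_discrete).mpr (h _ hρ)
  exact compl_mem_ae_iff.mpr e

/-- The states that are reachable in `n` steps. -/
def chainReach {X : Type*} (step : X → PMF X) (x₀ : X) : ℕ → Set X
  | 0 => {x₀}
  | n + 1 => ⋃ x ∈ chainReach step x₀ n, (step x).support

/-- The state space may be uncountable, as configurations carry real functions. Countability lets
null events be handled one current state at a time. -/
theorem chainReach_countable {X : Type*} (step : X → PMF X) (x₀ : X) (n : ℕ) :
    (chainReach step x₀ n).Countable := by
  induction n with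
  | zero => exact Set.countable_singleton _
  | succ n ih => exact ih.biUnion fun x _ => (step x).support_countable

theorem chainLaw_mem_chainReach (step : X → PMF X) (x₀ : X) (n : ℕ) :
    ∀ᵐ ρ ∂(chainLaw step x₀), ρ n ∈ chainReach step x₀ n := by
  induction n with
  | zero => filter_upwards [chainLaw_zero step x₀] with ρ h using h
  | succ n ih =>
    have h := chainLaw_ae_not_step step x₀ n (G := chainReach step x₀ n)
      (H := (chainReach step x₀ (n + 1))ᶜ) fun x hx => by
        rw [Set.disjoint_compl_right_iff_subset]
        exact Set.subset_biUnion_of_mem (u := fun x => (step x).support) hx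
    filter_upwards [ih, h] with ρ h1 h2
    by_contra h3
    exact h2 ⟨h1, h3⟩

/-- Almost surely, every step of the chain has positive probability. -/
theorem chainLaw_mem_support (step : X → PMF X) (x₀ : X) :
    ∀ᵐ ρ ∂(chainLaw step x₀), ρ 0 = x₀ ∧ ∀ n, ρ (n + 1) ∈ (step (ρ n)).support := by
  refine (chainLaw_zero step x₀).and (ae_all_iff.mpr fun n => ?_)
  have h : ∀ᵐ ρ ∂(chainLaw step x₀), ∀ x ∈ chainReach step x₀ n,
      ¬ (ρ n ∈ ({x} : Set X) ∧ ρ (n + 1) ∈ ((step x).support)ᶜ) := by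
    rw [ae_ball_iff (chainReach_countable step x₀ n)]
    intro x _
    refine chainLaw_ae_not_step step x₀ n fun y hy => ?_
    rw [Set.disjoint_compl_right_iff_subset, Set.mem_singleton_iff.mp hy]
  filter_upwards [h, chainLaw_mem_chainReach step x₀ n] with ρ h1 h2
  by_contra h3
  exact h1 _ h2 ⟨rfl, h3⟩

/-! ### Fairness of Markov chains, by a nonnegative supermartingale -/

/-- The factor by which the weight of a run is multiplied in a step: the weight vanishes after a
step from `G` to `H'`, and grows with each step from `G` to `H`. -/
noncomputable def fairFactor (G H H' : Set X) (c : ℝ≥0∞) (x y : X) : ℝ≥0∞ :=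
  open Classical in
  if x ∈ G then if y ∈ H' then 0 else if y ∈ H then (1 - c)⁻¹ else 1 else 1

theorem measurable_fairFactor (G H H' : Set X) (c : ℝ≥0∞) :
    Measurable (Function.uncurry (fairFactor G H H' c)) := by
  unfold fairFactor Function.uncurry
  refine Measurable.ite (measurable_fst MeasurableSet.of_discrete) ?_ measurable_const
  refine Measurable.ite (measurable_snd MeasurableSet.of_discrete) measurable_const ?_
  exact Measurable.ite (measurable_snd MeasurableSet.of_discrete) measurable_const measurable_const

/-- From a state of `G`, the set `H \ H'` has at most `1 - c` times the mass of `H`, so after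
multiplication by `(1 - c)⁻¹` it contributes no more than `H` did. -/
theorem lintegral_fairFactor_le (p : PMF X) {G H H' : Set X} {c : ℝ≥0∞} (hH : H' ⊆ H) (x : X)
    (h : x ∈ G → c * p.toMeasure H ≤ p.toMeasure H') :
    ∫⁻ y, fairFactor G H H' c x y ∂p.toMeasure ≤ 1 := by
  classical
  by_cases hx : x ∈ G
  · have e : ∀ y, fairFactor G H H' c x y =
        (Hᶜ).indicator 1 y + (1 - c)⁻¹ * (H \ H').indicator 1 y := by
      intro y
      by_cases h1 : y ∈ H'
      · simp [fairFactor, hx, h1, hH h1]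
      · by_cases h2 : y ∈ H <;> simp [fairFactor, hx, h1, h2]
    simp only [e]
    rw [lintegral_add_left Measurable.of_discrete,
      lintegral_const_mul _ Measurable.of_discrete,
      lintegral_indicator_one MeasurableSet.of_discrete,
      lintegral_indicator_one MeasurableSet.of_discrete]
    have h1 : p.toMeasure (H \ H') ≤ (1 - c) * p.toMeasure H := by
      rw [measure_sdiff hH MeasurableSet.of_discrete.nullMeasurableSet (measure_ne_top _ _),
        ENNReal.sub_mul (fun _ _ => measure_ne_top _ _), one_mul]
      exact tsub_le_tsub_left (h hx) _
    have h2 : (1 - c)⁻¹ * p.toMeasure (H \ H') ≤ p.toMeasure H := by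
      calc (1 - c)⁻¹ * p.toMeasure (H \ H') ≤ (1 - c)⁻¹ * ((1 - c) * p.toMeasure H) := by gcongr
        _ = ((1 - c)⁻¹ * (1 - c)) * p.toMeasure H := by rw [mul_assoc]
        _ ≤ 1 * p.toMeasure H := by gcongr; exact ENNReal.inv_mul_le_one _
        _ = _ := one_mul _
    calc p.toMeasure Hᶜ + (1 - c)⁻¹ * p.toMeasure (H \ H')
        ≤ p.toMeasure Hᶜ + p.toMeasure H := by gcongr
      _ = 1 := by rw [add_comm, measure_add_measure_compl MeasurableSet.of_discrete, measure_univ]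
  · simp [fairFactor, hx]

/-- The weight of a run, accumulated from time `N` on. -/
noncomputable def fairWeight (G H H' : Set X) (c : ℝ≥0∞) (N : ℕ) (ρ : ℕ → X) : ℕ → ℝ≥0∞
  | 0 => 1
  | n + 1 => fairWeight G H H' c N ρ n *
      if N ≤ n then fairFactor G H H' c (ρ n) (ρ (n + 1)) else 1

/-- The weight depends only on the history, the form in which `lintegral_chainLaw_succ` needs it. -/
theorem exists_fairWeight_eq (G H H' : Set X) (c : ℝ≥0∞) (N n : ℕ) :
    ∃ z : ((i : Finset.Iic n) → (fun _ : ℕ => X) i) → ℝ≥0∞, Measurable z ∧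
      ∀ ρ, fairWeight G H H' c N ρ n = z (frestrictLe n ρ) := by
  induction n with
  | zero => exact ⟨fun _ => 1, measurable_const, fun _ => rfl⟩
  | succ n ih =>
    obtain ⟨z, hz, h⟩ := ih
    refine ⟨fun k => z (frestrictLe₂ (π := fun _ : ℕ => X) n.le_succ k) * if N ≤ n then
      fairFactor G H H' c (k ⟨n, Finset.mem_Iic.mpr n.le_succ⟩)
        (k ⟨n + 1, Finset.mem_Iic.mpr le_rfl⟩) else 1, ?_, fun ρ => ?_⟩
    · refine (hz.comp (measurable_frestrictLe₂ _)).mul ?_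
      split_ifs
      · exact (measurable_fairFactor G H H' c).comp
          (g := Function.uncurry (fairFactor G H H' c))
          (f := fun k : (i : Finset.Iic (n + 1)) → (fun _ : ℕ => X) i =>
            (k ⟨n, Finset.mem_Iic.mpr n.le_succ⟩, k ⟨n + 1, Finset.mem_Iic.mpr le_rfl⟩))
          (Measurable.prodMk (measurable_pi_apply _) (measurable_pi_apply _))
      · exact measurable_const
    · rw [fairWeight, h]; rfl

theorem lintegral_fairWeight_le (step : X → PMF X) (x₀ : X) {G H H' : Set X} {c : ℝ≥0∞}
    (hH : H' ⊆ H) (h : ∀ x ∈ G, c * (step x).toMeasure H ≤ (step x).toMeasure H') (N n : ℕ) :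
    ∫⁻ ρ, fairWeight G H H' c N ρ n ∂(chainLaw step x₀) ≤ 1 := by
  induction n with
  | zero => simp [fairWeight]
  | succ n ih =>
    refine le_trans ?_ ih
    by_cases hN : N ≤ n
    · obtain ⟨z, hz, e⟩ := exists_fairWeight_eq G H H' c N n
      simp only [fairWeight, hN, if_true, e]
      rw [lintegral_chainLaw_succ step x₀ n z hz _ (measurable_fairFactor G H H' c)]
      refine lintegral_mono fun ρ => ?_
      exact mul_le_of_le_one_right' (lintegral_fairFactor_le _ hH _ (h _))
    · simp [fairWeight, hN]

/-- Without steps from `G` to `H'` after `N`, the weight never decreases, and each of the infinitely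
many steps from `G` to `H` multiplies it by a constant greater than 1. -/
theorem tendsto_fairWeight {X : Type*} {G H H' : Set X} {c : ℝ≥0∞} (hc : c ≠ 0) {N : ℕ} {ρ : ℕ → X}
    (h1 : ∃ᶠ n in atTop, ρ n ∈ G ∧ ρ (n + 1) ∈ H)
    (h2 : ∀ n, N ≤ n → ¬ (ρ n ∈ G ∧ ρ (n + 1) ∈ H')) :
    Tendsto (fairWeight G H H' c N ρ) atTop (𝓝 ⊤) := by
  have hr : 1 < (1 - c)⁻¹ := by
    rw [ENNReal.one_lt_inv]
    exact ENNReal.sub_lt_self ENNReal.one_ne_top one_ne_zero hc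
  have hge : ∀ n, N ≤ n → 1 ≤ fairFactor G H H' c (ρ n) (ρ (n + 1)) := by
    intro n hn
    have := h2 n hn
    unfold fairFactor
    split_ifs with a b d
    · exact absurd ⟨a, b⟩ this
    · exact hr.le
    · exact le_rfl
    · exact le_rfl
  have hmono : Monotone (fairWeight G H H' c N ρ) := by
    refine monotone_nat_of_le_succ fun n => ?_
    rw [fairWeight]
    refine le_mul_of_one_le_right' ?_
    split_ifs with hn
    · exact hge n hn
    · exact le_rfl
  have hk : ∀ k : ℕ, ∃ n, (1 - c)⁻¹ ^ k ≤ fairWeight G H H' c N ρ n := by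
    intro k
    induction k with
    | zero => exact ⟨0, by simp [fairWeight]⟩
    | succ k ih =>
      obtain ⟨n, hn⟩ := ih
      obtain ⟨m, hm, hG, hH⟩ := frequently_atTop.mp h1 (max n N)
      refine ⟨m + 1, ?_⟩
      have hNm : N ≤ m := (le_max_right _ _).trans hm
      rw [fairWeight, if_pos hNm, pow_succ]
      have : fairFactor G H H' c (ρ m) (ρ (m + 1)) = (1 - c)⁻¹ := by
        have := h2 m hNm
        simp only [fairFactor, hG, hH, if_true]
        rw [if_neg fun h => this ⟨hG, h⟩]
      rw [this]
      exact mul_le_mul_left (hn.trans (hmono ((le_max_left _ _).trans hm))) _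
  have hpow := ENNReal.tendsto_pow_atTop_nhds_top_iff.mpr hr
  rw [ENNReal.tendsto_nhds_top_iff_nat] at hpow ⊢
  intro x
  obtain ⟨k, hx⟩ := (hpow x).exists
  obtain ⟨n, hn⟩ := hk k
  filter_upwards [eventually_ge_atTop n] with m hm
  exact hx.trans_le (hn.trans (hmono hm))

/-- If from every state of `G` a step into `H'` is at least `c` times as likely as a step into
`H ⊇ H'`, then almost surely infinitely many steps from `G` into `H` entail infinitely many steps
from `G` into `H'`. -/
theorem chainLaw_fair (step : X → PMF X) (x₀ : X) {G H H' : Set X} {c : ℝ≥0∞} (hc : c ≠ 0)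
    (hH : H' ⊆ H) (h : ∀ x ∈ G, c * (step x).toMeasure H ≤ (step x).toMeasure H') :
    ∀ᵐ ρ ∂(chainLaw step x₀), (∃ᶠ n in atTop, ρ n ∈ G ∧ ρ (n + 1) ∈ H) →
      ∃ᶠ n in atTop, ρ n ∈ G ∧ ρ (n + 1) ∈ H' := by
  have hm : ∀ N n, Measurable fun ρ => fairWeight G H H' c N ρ n := by
    intro N n
    obtain ⟨z, hz, e⟩ := exists_fairWeight_eq G H H' c N n
    simp only [e]
    exact hz.comp (by fun_prop)
  -- By Fatou's lemma the lower limit of the weights has integral at most 1. The unfair runs are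
  -- those on which some weight tends to infinity.
  have hfin : ∀ᵐ ρ ∂(chainLaw step x₀), ∀ N,
      liminf (fun n => fairWeight G H H' c N ρ n) atTop < ⊤ := by
    refine ae_all_iff.mpr fun N => ae_lt_top (Measurable.liminf (hm N)) (ne_of_lt ?_)
    refine lt_of_le_of_lt (lintegral_liminf_le (hm N)) ?_
    refine lt_of_le_of_lt (b := 1) ?_ ENNReal.one_lt_top
    refine liminf_le_of_le (by isBoundedDefault) fun b hb => ?_
    obtain ⟨n, hn⟩ := hb.exists
    exact hn.trans (lintegral_fairWeight_le step x₀ hH h N n)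
  filter_upwards [hfin] with ρ hρ h1
  by_contra h2
  obtain ⟨N, hN⟩ := eventually_atTop.mp (not_frequently.mp h2)
  exact (hρ N).ne (tendsto_fairWeight hc h1 hN).liminf_eq

end ChainFacts

/-! ### Integrals and averages for discrete distributions -/

section PMFFacts

open scoped ENNReal

variable {X Y : Type*} [MeasurableSpace X] [DiscreteMeasurableSpace X]

theorem PMF.lintegral_eq_tsum' (p : PMF X) (f : X → ℝ≥0∞) :
    ∫⁻ x, f x ∂p.toMeasure = ∑' x, p x * f x := by
  rw [← PMF.restrict_toMeasure_support p, lintegral_countable f p.support_countable,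
    ← tsum_subtype_eq_of_support_subset (s := p.support)]
  · refine tsum_congr fun x => ?_
    rw [PMF.toMeasure_apply_singleton _ _ (MeasurableSet.singleton _), mul_comm]
  · intro x hx
    exact fun h => hx (by simp [h])

theorem PMF.lintegral_bind (p : PMF Y) (k : Y → PMF X) (f : X → ℝ≥0∞) :
    ∫⁻ x, f x ∂(p.bind k).toMeasure = ∑' y, p y * ∫⁻ x, f x ∂(k y).toMeasure := by
  simp only [PMF.lintegral_eq_tsum', PMF.bind_apply, ← ENNReal.tsum_mul_right,
    ← ENNReal.tsum_mul_left]
  rw [ENNReal.tsum_comm]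
  simp only [mul_assoc]

theorem PMF.lintegral_map (p : PMF Y) (k : Y → X) (f : X → ℝ≥0∞) :
    ∫⁻ x, f x ∂(p.map k).toMeasure = ∑' y, p y * f (k y) := by
  rw [← PMF.bind_pure_comp, PMF.lintegral_bind]
  refine tsum_congr fun y => ?_
  rw [Function.comp_apply, PMF.toMeasure_pure, lintegral_dirac]

theorem PMF.sum_toReal {S : Type*} [Fintype S] (p : PMF S) : ∑ s, (p s).toReal = 1 := by
  rw [← ENNReal.toReal_sum fun s _ => p.apply_ne_top s]
  have := p.tsum_coe
  rw [tsum_fintype] at this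
  simp [this]

theorem PMF.ofReal_sum_toReal_mul {S : Type*} [Fintype S] (p : PMF S) {W : S → ℝ}
    (hW : ∀ s, 0 ≤ W s) :
    ENNReal.ofReal (∑ s, (p s).toReal * W s) = ∑ s, p s * ENNReal.ofReal (W s) := by
  rw [ENNReal.ofReal_sum_of_nonneg fun s _ => mul_nonneg ENNReal.toReal_nonneg (hW s)]
  refine Finset.sum_congr rfl fun s _ => ?_
  rw [ENNReal.ofReal_mul ENNReal.toReal_nonneg, ENNReal.ofReal_toReal (p.apply_ne_top s)]

theorem PMF.sum_toReal_mul_mono {S : Type*} [Fintype S] (p : PMF S) {f g : S → ℝ}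
    (h : ∀ s, f s ≤ g s) : ∑ s, (p s).toReal * f s ≤ ∑ s, (p s).toReal * g s :=
  Finset.sum_le_sum fun s _ => mul_le_mul_of_nonneg_left (h s) ENNReal.toReal_nonneg

theorem PMF.sum_toReal_mul_of_eq_one {S : Type*} [Fintype S] (p : PMF S) {s : S} (h : p s = 1)
    (f : S → ℝ) : ∑ t, (p t).toReal * f t = f s := by
  have hs := (p.apply_eq_one_iff s).mp h
  rw [Finset.sum_eq_single s, h]
  · simp
  · intro t _ ht
    have : t ∉ p.support := by rw [hs]; exact ht
    rw [(p.apply_eq_zero_iff t).mpr this]; simp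
  · simp

end PMFFacts

/-! ### Markov decision processes: maximum principle and bounds on the value -/

namespace MDP

open scoped ENNReal

variable {S A : Type*} {M : MDP S A} {zero one : S}

theorem le_maxE (W : S → A → ℝ) {s : S} {a : A} (ha : a ∈ M.E s) : W s a ≤ M.maxE W s :=
  Finset.le_sup' (W s) ha

theorem maxE_le {W : S → A → ℝ} {s : S} {r : ℝ} (h : ∀ a ∈ M.E s, W s a ≤ r) :
    M.maxE W s ≤ r :=
  Finset.sup'_le _ _ h

theorem maxE_mono {W W' : S → A → ℝ} {s : S} (h : ∀ a ∈ M.E s, W s a ≤ W' s a) :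
    M.maxE W s ≤ M.maxE W' s :=
  maxE_le fun a ha => (h a ha).trans (le_maxE W' ha)

theorem exists_maxE_eq (W : S → A → ℝ) (s : S) : ∃ a ∈ M.E s, M.maxE W s = W s a :=
  Finset.exists_mem_eq_sup' _ _

theorem maxE_eq_of_forall_eq {r : ℝ} {W : S → A → ℝ} {s : S} (h : ∀ a ∈ M.E s, W s a = r) :
    M.maxE W s = r := by
  obtain ⟨a, ha, e⟩ := exists_maxE_eq (M := M) W s
  rw [e, h a ha]

theorem mem_E_of_mem_argmaxE {W : S → A → ℝ} {s : S} {a : A} (h : a ∈ M.argmaxE W s) :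
    a ∈ M.E s := by
  classical
  exact (Finset.mem_filter.mp h).1

theorem maxE_eq_of_mem_argmaxE {W : S → A → ℝ} {s : S} {a : A} (h : a ∈ M.argmaxE W s) :
    M.maxE W s = W s a := by
  classical
  obtain ⟨h1, h2⟩ := Finset.mem_filter.mp h
  exact le_antisymm (maxE_le h2) (le_maxE W h1)

theorem tendsto_maxE {W : ℕ → S → A → ℝ} {w : S → A → ℝ} {s : S}
    (h : ∀ a ∈ M.E s, Tendsto (fun n => W n s a) atTop (𝓝 (w s a))) :
    Tendsto (fun n => M.maxE (W n) s) atTop (𝓝 (M.maxE w s)) :=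
  Tendsto.finset_sup'_nhds_apply (M.E_nonempty s) h

theorem lintegral_pathMeasure_zero (σ : M.Strategy) (s : S) (g : S → ℝ≥0∞) :
    ∫⁻ ω, g (ω 0).last ∂(M.pathMeasure σ s) = g s := by
  rw [lintegral_congr_ae (g := fun _ => g s)]
  · simp [pathMeasure]
  · filter_upwards [chainLaw_zero (M.strategyStep σ) (FinPath.start s)] with ω h
    rw [h]; rfl

theorem measurable_last (n : ℕ) (g : S → ℝ≥0∞) :
    Measurable fun ω : ℕ → FinPath S A => g (ω n).last :=
  (Measurable.of_discrete (f := fun y : FinPath S A => g y.last)).comp (measurable_pi_apply n)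

/-- Almost surely, a terminal state is never left. -/
theorem pathMeasure_terminal (σ : M.Strategy) (s : S) {t : S} (ht : M.IsTerminal t) :
    ∀ᵐ ω ∂(M.pathMeasure σ s), ∀ n, (ω n).last = t → ∀ m, n ≤ m → (ω m).last = t := by
  filter_upwards [chainLaw_mem_support (M.strategyStep σ) (FinPath.start s)] with ω h n hn m hm
  induction m, hm using Nat.le_induction with
  | base => exact hn
  | succ m _ ih =>
    have := h.2 m
    rw [strategyStep, PMF.mem_support_bind_iff] at this
    obtain ⟨a, ha, h'⟩ := this
    rw [PMF.mem_support_map_iff] at h'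
    obtain ⟨s', hs', e⟩ := h'
    have h1 := ht a (ih ▸ σ.enabled _ a ha)
    rw [ih, (PMF.apply_eq_one_iff _ _).mp h1] at hs'
    rw [← e]
    exact hs'

theorem reachProb_le_one (F : Set S) (σ : M.Strategy) (s : S) : M.reachProb F σ s ≤ 1 := by
  have : IsProbabilityMeasure (M.pathMeasure σ s) :=
    inferInstanceAs (IsProbabilityMeasure (chainLaw _ _))
  exact measureReal_le_one

theorem reachProb_le_stateValue (F : Set S) (σ : M.Strategy) (s : S) :
    M.reachProb F σ s ≤ M.stateValue F s :=
  le_ciSup (f := fun σ => M.reachProb F σ s)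
    ⟨1, by rintro _ ⟨σ, rfl⟩; exact reachProb_le_one F σ s⟩ σ

/-- The strategy that takes the action `π s` in the state `s`. -/
noncomputable def positional (π : S → A) (hπ : ∀ s, π s ∈ M.E s) : M.Strategy where
  act ω := PMF.pure (π ω.last)
  enabled ω a ha := by
    rw [PMF.support_pure, Set.mem_singleton_iff] at ha
    exact ha ▸ hπ _

theorem measurableSet_last_eq (n : ℕ) (t : S) :
    MeasurableSet {ω : ℕ → FinPath S A | (ω n).last ∈ ({t} : Set S)} := by
  have : MeasurableSet {y : FinPath S A | y.last ∈ ({t} : Set S)} := MeasurableSet.of_discrete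
  exact this.preimage (measurable_pi_apply (X := fun _ : ℕ => FinPath S A) n)

variable [Fintype S]

/-- A nonempty set of states within which one can stay forever contains an end component, and
hence one of the two terminal states. -/
theorem OnlyTrivialECs.mem_of_closed (hM : M.OnlyTrivialECs zero one) {T : Set S}
    (hT : T.Nonempty) (h : ∀ s ∈ T, ∃ a ∈ M.E s, ∀ s', 0 < M.Δ s a s' → s' ∈ T) :
    zero ∈ T ∨ one ∈ T := by
  have : Nonempty A := ⟨(M.E_nonempty M.init).choose⟩
  choose! π hE hπ using h
  let R : S → S → Prop := fun x y => 0 < M.Δ x (π x) y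
  let reach : S → Set S := fun x => {y | Relation.ReflTransGen R x y}
  have hsub : ∀ x ∈ T, reach x ⊆ T := by
    intro x hx y hy
    induction hy with
    | refl => exact hx
    | tail _ h ih => exact hπ _ ih _ h
  -- A smallest reachable set is a bottom strongly connected component of the graph of `π`: all its
  -- states reach the same set.
  obtain ⟨s, hs, hmin⟩ := Set.exists_min_image T (fun x => (reach x).ncard) T.toFinite hT
  have heq : ∀ x ∈ reach s, reach x = reach s := by
    intro x hx
    refine Set.eq_of_subset_of_ncard_le (fun y hy => ?_) (hmin x (hsub s hs hx)) (Set.toFinite _)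
    exact Relation.ReflTransGen.trans hx hy
  have hec : M.IsEndComponent (reach s) {p | p.1 ∈ reach s ∧ p.2 = π p.1} := by
    refine ⟨⟨(s, π s), Relation.ReflTransGen.refl, rfl⟩, ?_, ?_, ?_⟩
    · rintro ⟨x, a⟩ ⟨hx, h⟩
      exact ⟨hx, h ▸ hE _ (hsub s hs hx)⟩
    · rintro ⟨x, a⟩ ⟨hx, h⟩ y hy
      obtain rfl : a = π x := h
      exact Relation.ReflTransGen.tail hx hy
    · intro x hx y hy
      rw [← heq x hx] at hy
      have hy' : Relation.ReflTransGen R x y := hy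
      induction hy' with
      | refl => exact Relation.ReflTransGen.refl
      | @tail b c hxb hbc ih =>
        refine Relation.ReflTransGen.tail (ih hxb) ⟨π b, ⟨?_, rfl⟩, hbc⟩
        exact Relation.ReflTransGen.trans hx hxb
  rcases hM.trivial_of_ec _ _ hec with h | h
  · exact Or.inl (hsub s hs (h ▸ rfl))
  · exact Or.inr (hsub s hs (h ▸ rfl))

/-- Maximum principle: a function that is nonpositive at the terminal states and at most its
expected value after some action is nonpositive. -/
theorem OnlyTrivialECs.nonpos_of_le_sum (hM : M.OnlyTrivialECs zero one) {T : Set S} {f : S → ℝ}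
    (h0 : f zero ≤ 0) (h1 : f one ≤ 0)
    (h : ∀ s ∈ T, s ≠ zero → s ≠ one → ∃ a ∈ M.E s,
      (∀ s', 0 < M.Δ s a s' → s' ∈ T ∨ s' = zero ∨ s' = one) ∧
        f s ≤ ∑ s', (M.Δ s a s').toReal * f s') :
    ∀ s ∈ T, f s ≤ 0 := by
  intro s₁ hs₁
  by_contra! hpos
  let T₁ : Set S := {s | s ∈ T ∨ s = zero ∨ s = one}
  obtain ⟨s₀, hs₀, hmax⟩ := Set.exists_max_image T₁ f T₁.toFinite ⟨s₁, Or.inl hs₁⟩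
  have hpos₀ : 0 < f s₀ := hpos.trans_le (hmax s₁ (Or.inl hs₁))
  have hne : ∀ s, f s = f s₀ → s ≠ zero ∧ s ≠ one := by
    intro s hs
    constructor <;> rintro rfl <;> linarith
  -- An average that reaches the maximum forces every successor of positive probability to be a
  -- maximiser.
  have hcl : ∀ s ∈ {s | s ∈ T₁ ∧ f s = f s₀}, ∃ a ∈ M.E s,
      ∀ s', 0 < M.Δ s a s' → s' ∈ {s | s ∈ T₁ ∧ f s = f s₀} := by
    rintro s ⟨hs, hfs⟩
    obtain ⟨hs0, hs1⟩ := hne s hfs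
    have hsT : s ∈ T := by
      rcases hs with hs | hs | hs
      exacts [hs, absurd hs hs0, absurd hs hs1]
    obtain ⟨a, ha, hcl, hle⟩ := h s hsT hs0 hs1
    refine ⟨a, ha, fun s' hs' => ⟨hcl s' hs', ?_⟩⟩
    by_contra hlt
    have hlt' : f s' < f s₀ := lt_of_le_of_ne (hmax s' (hcl s' hs')) hlt
    have : ∑ t, (M.Δ s a t).toReal * f t < ∑ t, (M.Δ s a t).toReal * f s₀ := by
      refine Finset.sum_lt_sum (fun t _ => ?_) ⟨s', Finset.mem_univ _, ?_⟩
      · rcases eq_or_ne (M.Δ s a t) 0 with ht | ht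
        · simp [ht]
        · exact mul_le_mul_of_nonneg_left (hmax t (hcl t (pos_iff_ne_zero.mpr ht)))
            ENNReal.toReal_nonneg
      · exact mul_lt_mul_of_pos_left hlt'
          (ENNReal.toReal_pos hs'.ne' ((M.Δ s a).apply_ne_top s'))
    rw [← Finset.sum_mul, PMF.sum_toReal, one_mul] at this
    linarith
  rcases hM.mem_of_closed (T := {s | s ∈ T₁ ∧ f s = f s₀})
      (Set.nonempty_of_mem (x := s₀) ⟨hs₀, rfl⟩) hcl with hz | ho
  · exact (hne _ hz.2).1 rfl
  · exact (hne _ ho.2).2 rfl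

theorem lintegral_strategyStep (σ : M.Strategy) (ω : FinPath S A) (g : S → ℝ≥0∞) :
    ∫⁻ y, g y.last ∂(M.strategyStep σ ω).toMeasure =
      ∑' a, σ.act ω a * ∑ s, M.Δ ω.last a s * g s := by
  rw [strategyStep, PMF.lintegral_bind]
  refine tsum_congr fun a => ?_
  rw [PMF.lintegral_map, tsum_fintype]
  rfl

theorem lintegral_pathMeasure_succ (σ : M.Strategy) (s : S) (n : ℕ) (g : S → ℝ≥0∞) :
    ∫⁻ ω, g (ω (n + 1)).last ∂(M.pathMeasure σ s) =
      ∫⁻ ω, ∑' a, σ.act (ω n) a * ∑ s, M.Δ (ω n).last a s * g s ∂(M.pathMeasure σ s) := by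
  have := lintegral_chainLaw_succ (M.strategyStep σ) (FinPath.start s) n (fun _ => 1)
    measurable_const (fun _ y => g y.last)
    ((Measurable.of_discrete (f := fun y : FinPath S A => g y.last)).comp measurable_snd)
  simp only [one_mul, lintegral_strategyStep] at this
  exact this

/-- Along the paths of any strategy, the expectation of `W` at the last state never exceeds its
initial value. On a path that reaches `one`, this state is never left, so the lower limit of `W` is
at least 1, and Fatou's lemma applies. -/
theorem reachProb_le_of_supersolution (ht : M.IsTerminal one) {W : S → ℝ} (h0 : ∀ s, 0 ≤ W s)
    (h1 : 1 ≤ W one) (h : ∀ s, ∀ a ∈ M.E s, ∑ s', (M.Δ s a s').toReal * W s' ≤ W s)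
    (σ : M.Strategy) (s : S) : M.reachProb {one} σ s ≤ W s := by
  let g : S → ℝ≥0∞ := fun s => ENNReal.ofReal (W s)
  have hstep : ∀ s, ∀ a ∈ M.E s, ∑ s', M.Δ s a s' * g s' ≤ g s := by
    intro s a ha
    rw [← PMF.ofReal_sum_toReal_mul _ h0]
    exact ENNReal.ofReal_le_ofReal (h s a ha)
  have hn : ∀ n, ∫⁻ ω, g (ω n).last ∂(M.pathMeasure σ s) ≤ g s := by
    intro n
    induction n with
    | zero => rw [lintegral_pathMeasure_zero]
    | succ n ih =>
      refine le_trans ?_ ih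
      rw [lintegral_pathMeasure_succ]
      refine lintegral_mono fun ω => ?_
      calc ∑' a, σ.act (ω n) a * ∑ s, M.Δ (ω n).last a s * g s
          ≤ ∑' a, σ.act (ω n) a * g (ω n).last := by
            refine ENNReal.tsum_le_tsum fun a => ?_
            rcases eq_or_ne (σ.act (ω n) a) 0 with h | h
            · simp [h]
            · gcongr
              exact hstep _ _ (σ.enabled _ a ((PMF.mem_support_iff _ _).mpr h))
        _ = g (ω n).last := by rw [ENNReal.tsum_mul_right, PMF.tsum_coe, one_mul]
  have hmeas : MeasurableSet {ω : ℕ → FinPath S A | ∃ n, (ω n).last ∈ ({one} : Set S)} := by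
    rw [Set.ofPred_exists]
    exact MeasurableSet.iUnion fun n => measurableSet_last_eq n one
  have hle : M.pathMeasure σ s {ω | ∃ n, (ω n).last ∈ ({one} : Set S)} ≤ g s := by
    rw [← lintegral_indicator_one hmeas]
    calc _ ≤ ∫⁻ ω, liminf (fun n => g (ω n).last) atTop ∂(M.pathMeasure σ s) := by
          refine lintegral_mono_ae ?_
          filter_upwards [pathMeasure_terminal σ s ht] with ω hω
          by_cases h : ∃ n, (ω n).last ∈ ({one} : Set S)
          · obtain ⟨n, hn⟩ := h
            refine (Set.indicator_le_self' (fun _ _ => zero_le) ω).trans ?_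
            refine le_liminf_of_le (by isBoundedDefault) ?_
            filter_upwards [eventually_ge_atTop n] with m hm
            rw [hω n hn m hm]
            simpa [g] using h1
          · exact (Set.indicator_of_notMem (s := {ω : ℕ → FinPath S A | ∃ n, (ω n).last ∈ ({one} : Set S)})
              h _).trans_le zero_le
      _ ≤ liminf (fun n => ∫⁻ ω, g (ω n).last ∂(M.pathMeasure σ s)) atTop :=
          lintegral_liminf_le fun n => measurable_last n g
      _ ≤ g s := by
          refine liminf_le_of_le (by isBoundedDefault) fun b hb => ?_
          obtain ⟨n, hn'⟩ := hb.exists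
          exact hn'.trans (hn n)
  exact ENNReal.toReal_le_of_le_ofReal (h0 s) hle

variable (M one) in
/-- The probability of being in the state `one` after `n` steps when taking the action `π s` in
the state `s`. -/
noncomputable def positionalReach (π : S → A) : ℕ → S → ℝ≥0∞
  | 0 => ({one} : Set S).indicator 1
  | n + 1 => fun s => ∑ s', M.Δ s (π s) s' * positionalReach π n s'

/-- Here `n` steps are made by the path and `k` by the recursion; the induction shifts one step at a
time from the former to the latter. -/
theorem lintegral_positionalReach {π : S → A} (hπ : ∀ s, π s ∈ M.E s) (s : S) (n k : ℕ) :
    ∫⁻ ω, positionalReach M one π k (ω n).last ∂(M.pathMeasure (positional π hπ) s) =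
      positionalReach M one π (n + k) s := by
  induction n generalizing k with
  | zero => rw [lintegral_pathMeasure_zero, zero_add]
  | succ n ih =>
    rw [lintegral_pathMeasure_succ, show n + 1 + k = n + (k + 1) by omega, ← ih]
    refine lintegral_congr fun ω => ?_
    rw [tsum_eq_single (π (ω n).last)]
    · simp [positional, positionalReach]
    · intro a ha
      simp [positional, ha]

theorem positionalReach_le {π : S → A} (hπ : ∀ s, π s ∈ M.E s) (s : S) (n : ℕ) :
    positionalReach M one π n s ≤
      M.pathMeasure (positional π hπ) s {ω | ∃ n, (ω n).last ∈ ({one} : Set S)} := by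
  have := lintegral_positionalReach (one := one) hπ s n 0
  rw [add_zero] at this
  rw [← this]
  have hmeas := measurableSet_last_eq (A := A) n one
  calc _ = M.pathMeasure (positional π hπ) s {ω | (ω n).last ∈ ({one} : Set S)} := by
        rw [← lintegral_indicator_one hmeas]; rfl
    _ ≤ _ := measure_mono (Set.ofPred_subset_ofPred.mpr fun ω h => ⟨n, h⟩)

/-- As `one` is terminal, being there after `n` steps entails being there after `n + 1`. -/
theorem positionalReach_mono {π : S → A} (hπ : ∀ s, π s ∈ M.E s) (ht : M.IsTerminal one) :
    Monotone (positionalReach M one π) := by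
  refine monotone_nat_of_le_succ fun n => ?_
  induction n with
  | zero =>
    intro s
    by_cases h : s = one
    · subst h
      have h1 := ht _ (hπ s)
      calc positionalReach M s π 0 s = M.Δ s (π s) s * positionalReach M s π 0 s := by
            rw [h1, one_mul]
        _ ≤ _ := Finset.single_le_sum
            (f := fun s' => M.Δ s (π s) s' * positionalReach M s π 0 s')
            (fun _ _ => zero_le) (Finset.mem_univ s)
    · simp [positionalReach, h]
  | succ n ih =>
    intro s
    exact Finset.sum_le_sum fun s' _ => mul_le_mul_right (ih s') _

/-- In the absence of nontrivial end components, a subsolution is a lower bound of the value. -/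
theorem OnlyTrivialECs.le_stateValue_of_subsolution (hM : M.OnlyTrivialECs zero one) {W : S → ℝ}
    (h0 : W zero ≤ 0) (h1 : W one ≤ 1)
    (h : ∀ s, ∃ a ∈ M.E s, W s ≤ ∑ s', (M.Δ s a s').toReal * W s') (s : S) :
    W s ≤ M.stateValue {one} s := by
  choose π hπ hW using h
  let r : S → ℝ≥0∞ := fun s => ⨆ n, positionalReach M one π n s
  have hr : ∀ s, r s ≤
      M.pathMeasure (positional π hπ) s {ω | ∃ n, (ω n).last ∈ ({one} : Set S)} :=
    fun s => iSup_le fun n => positionalReach_le hπ s n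
  have : ∀ s, IsProbabilityMeasure (M.pathMeasure (positional π hπ) s) :=
    fun s => inferInstanceAs (IsProbabilityMeasure (chainLaw _ _))
  have hrt : ∀ s, r s ≠ ⊤ := fun s => ne_top_of_le_ne_top (measure_ne_top _ _) (hr s)
  have hmono := positionalReach_mono hπ hM.terminal_one
  have hlim : ∀ s, Tendsto (fun n => positionalReach M one π n s) atTop (𝓝 (r s)) :=
    fun s => tendsto_atTop_iSup fun m n hmn => hmono hmn s
  -- The limit `r` solves the equation of `π` exactly, so `W - r` is at most its average after `π
  -- s`, as the maximum principle requires.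
  have hfix : ∀ s, r s = ∑ s', M.Δ s (π s) s' * r s' := by
    intro s
    refine tendsto_nhds_unique ((tendsto_add_atTop_iff_nat 1).mpr (hlim s)) ?_
    exact tendsto_finsetSum _ fun s' _ =>
      ENNReal.Tendsto.const_mul (hlim s') (Or.inr ((M.Δ s (π s)).apply_ne_top s'))
  have hle : W s - (r s).toReal ≤ 0 := by
    refine hM.nonpos_of_le_sum (T := Set.univ) (f := fun s => W s - (r s).toReal) ?_ ?_ ?_ s
      (Set.mem_univ s)
    · simpa using h0.trans ENNReal.toReal_nonneg
    · have h2 : 1 ≤ r one := by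
        refine le_trans ?_ (le_iSup (fun n => positionalReach M one π n one) 0)
        simp [positionalReach]
      have := ENNReal.toReal_mono (hrt one) h2
      rw [ENNReal.toReal_one] at this
      linarith
    · intro s _ _ _
      refine ⟨π s, hπ s, fun _ _ => Or.inl (Set.mem_univ _), ?_⟩
      have e : (r s).toReal = ∑ s', (M.Δ s (π s) s').toReal * (r s').toReal := by
        conv_lhs => rw [hfix s]
        rw [ENNReal.toReal_sum fun s' _ =>
          ENNReal.mul_ne_top ((M.Δ s (π s)).apply_ne_top s') (hrt s')]
        simp only [ENNReal.toReal_mul]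
      simp only [mul_sub, Finset.sum_sub_distrib]
      rw [← e]
      linarith [hW s]
  calc W s ≤ (r s).toReal := by linarith
    _ ≤ M.reachProb {one} (positional π hπ) s := ENNReal.toReal_mono (measure_ne_top _ _) (hr s)
    _ ≤ _ := reachProb_le_stateValue _ _ s

theorem stateValue_le_of_supersolution (ht : M.IsTerminal one) {W : S → ℝ} (h0 : ∀ s, 0 ≤ W s)
    (h1 : 1 ≤ W one) (h : ∀ s, ∀ a ∈ M.E s, ∑ s', (M.Δ s a s').toReal * W s' ≤ W s) (s : S) :
    M.stateValue {one} s ≤ W s := by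
  have : Nonempty M.Strategy :=
    ⟨positional (fun s => (M.E_nonempty s).choose) fun s => (M.E_nonempty s).choose_spec⟩
  exact ciSup_le fun σ => reachProb_le_of_supersolution ht h0 h1 h σ s

end MDP

/-! ### Invariants of the bounds, and the possible steps of the algorithm -/

namespace BRTDP

open MDP
open scoped ENNReal

variable {S A : Type*} [Fintype S] {M : MDP S A} {zero one : S}
  {quit : (S → A → ℝ) → (S → A → ℝ) → Prop}

theorem backup_self (W : S → A → ℝ) (s : S) (a : A) :
    backup M W s a s a = ∑ s', (M.Δ s a s').toReal * M.maxE W s' := by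
  simp [backup]

theorem backup_of_ne (W : S → A → ℝ) {s t : S} {a b : A} (h : ¬ (t = s ∧ b = a)) :
    backup M W s a t b = W t b := by
  simp only [backup, if_neg h]

/-- The values of the pairs of state and action are at least those obtained by backups. -/
def IsSuper (M : MDP S A) (W : S → A → ℝ) : Prop :=
  ∀ s, ∀ a ∈ M.E s, ∑ s', (M.Δ s a s').toReal * M.maxE W s' ≤ W s a

/-- The values of the pairs of state and action are at most those obtained by backups. -/
def IsSub (M : MDP S A) (W : S → A → ℝ) : Prop :=
  ∀ s, ∀ a ∈ M.E s, W s a ≤ ∑ s', (M.Δ s a s').toReal * M.maxE W s'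

theorem IsSuper.backup_le {W : S → A → ℝ} (h : IsSuper M W) (t : S) (b : A) {s : S} {a : A}
    (ha : a ∈ M.E s) : backup M W t b s a ≤ W s a := by
  by_cases e : s = t ∧ a = b
  · obtain ⟨rfl, rfl⟩ := e
    rw [backup_self]
    exact h s a ha
  · rw [backup_of_ne _ e]

/-- The backup lowers `W`, hence all one-step averages. At the pair backed up, the new value is the
old average, which dominates the new one. -/
theorem IsSuper.backup {W : S → A → ℝ} (h : IsSuper M W) (t : S) (b : A) :
    IsSuper M (backup M W t b) := by
  intro s a ha
  have h1 : ∑ s', (M.Δ s a s').toReal * M.maxE (BRTDP.backup M W t b) s' ≤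
      ∑ s', (M.Δ s a s').toReal * M.maxE W s' :=
    PMF.sum_toReal_mul_mono _ fun s' => maxE_mono fun a' ha' => h.backup_le t b ha'
  refine h1.trans ?_
  by_cases e : s = t ∧ a = b
  · obtain ⟨rfl, rfl⟩ := e
    rw [backup_self]
  · rw [backup_of_ne _ e]
    exact h s a ha

theorem IsSub.le_backup {W : S → A → ℝ} (h : IsSub M W) (t : S) (b : A) {s : S} {a : A}
    (ha : a ∈ M.E s) : W s a ≤ backup M W t b s a := by
  by_cases e : s = t ∧ a = b
  · obtain ⟨rfl, rfl⟩ := e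
    rw [backup_self]
    exact h s a ha
  · rw [backup_of_ne _ e]

theorem IsSub.backup {W : S → A → ℝ} (h : IsSub M W) (t : S) (b : A) :
    IsSub M (backup M W t b) := by
  intro s a ha
  have h1 : ∑ s', (M.Δ s a s').toReal * M.maxE W s' ≤
      ∑ s', (M.Δ s a s').toReal * M.maxE (BRTDP.backup M W t b) s' :=
    PMF.sum_toReal_mul_mono _ fun s' => maxE_mono fun a' ha' => h.le_backup t b ha'
  refine le_trans ?_ h1
  by_cases e : s = t ∧ a = b
  · obtain ⟨rfl, rfl⟩ := e
    rw [backup_self]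
  · rw [backup_of_ne _ e]
    exact h s a ha

/-- The properties of the bounds that are preserved by the algorithm. -/
structure BoundsInv (M : MDP S A) (zero one : S) (U L : S → A → ℝ) : Prop where
  super : IsSuper M U
  sub : IsSub M L
  nonneg : ∀ s, ∀ a ∈ M.E s, 0 ≤ U s a
  one_le : ∀ a ∈ M.E one, 1 ≤ U one a
  le_one : ∀ a ∈ M.E one, L one a ≤ 1
  le_zero : ∀ a ∈ M.E zero, L zero a ≤ 0

theorem boundsInv_initial (hM : M.OnlyTrivialECs zero one) :
    BoundsInv M zero one (initial M zero one).U (initial M zero one).L := by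
  classical
  have hU : ∀ s a, (initial M zero one).U s a = if s = zero then 0 else 1 := fun _ _ => by
    simp [initial]
  have hL : ∀ s a, (initial M zero one).L s a = if s = one then 1 else 0 := fun _ _ => by
    simp [initial]
  have hU' : ∀ s, M.maxE (initial M zero one).U s = if s = zero then 0 else 1 :=
    fun s => maxE_eq_of_forall_eq fun a _ => hU s a
  have hL' : ∀ s, M.maxE (initial M zero one).L s = if s = one then 1 else 0 :=
    fun s => maxE_eq_of_forall_eq fun a _ => hL s a
  refine ⟨fun s a ha => ?_, fun s a ha => ?_, fun s a _ => ?_, fun a _ => ?_, fun a _ => ?_,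
    fun a _ => ?_⟩
  · by_cases h : s = zero
    · subst h
      rw [PMF.sum_toReal_mul_of_eq_one _ (hM.terminal_zero a ha), hU', hU]
    · rw [hU, if_neg h, ← PMF.sum_toReal (M.Δ s a)]
      refine Finset.sum_le_sum fun s' _ => mul_le_of_le_one_right ENNReal.toReal_nonneg ?_
      rw [hU']; split_ifs <;> norm_num
  · by_cases h : s = one
    · subst h
      rw [PMF.sum_toReal_mul_of_eq_one _ (hM.terminal_one a ha), hL', hL]
    · rw [hL, if_neg h]
      refine Finset.sum_nonneg fun s' _ => mul_nonneg ENNReal.toReal_nonneg ?_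
      rw [hL']; split_ifs <;> norm_num
  · rw [hU]; split_ifs <;> norm_num
  · rw [hU, if_neg hM.ne.symm]
  · rw [hL, if_pos rfl]
  · rw [hL, if_neg hM.ne]

theorem BoundsInv.backup (hM : M.OnlyTrivialECs zero one) {U L : S → A → ℝ}
    (h : BoundsInv M zero one U L) (t : S) (b : A) :
    BoundsInv M zero one (backup M U t b) (backup M L t b) := by
  have hmax : ∀ s, 0 ≤ M.maxE U s := fun s => by
    obtain ⟨a, ha, e⟩ := exists_maxE_eq (M := M) U s
    exact e ▸ h.nonneg s a ha
  refine ⟨h.super.backup t b, h.sub.backup t b, fun s a ha => ?_, fun a ha => ?_, fun a ha => ?_,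
    fun a ha => ?_⟩
  · by_cases e : s = t ∧ a = b
    · obtain ⟨rfl, rfl⟩ := e
      rw [backup_self]
      exact Finset.sum_nonneg fun s' _ => mul_nonneg ENNReal.toReal_nonneg (hmax s')
    · rw [backup_of_ne _ e]
      exact h.nonneg s a ha
  · by_cases e : one = t ∧ a = b
    · obtain ⟨rfl, rfl⟩ := e
      rw [backup_self, PMF.sum_toReal_mul_of_eq_one _ (hM.terminal_one a ha)]
      exact (h.one_le a ha).trans (le_maxE U ha)
    · rw [backup_of_ne _ e]
      exact h.one_le a ha
  · by_cases e : one = t ∧ a = b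
    · obtain ⟨rfl, rfl⟩ := e
      rw [backup_self, PMF.sum_toReal_mul_of_eq_one _ (hM.terminal_one a ha)]
      exact maxE_le h.le_one
    · rw [backup_of_ne _ e]
      exact h.le_one a ha
  · by_cases e : zero = t ∧ a = b
    · obtain ⟨rfl, rfl⟩ := e
      rw [backup_self, PMF.sum_toReal_mul_of_eq_one _ (hM.terminal_zero a ha)]
      exact maxE_le h.le_zero
    · rw [backup_of_ne _ e]
      exact h.le_zero a ha

/-- The maxima of `L` over actions form a subsolution on states; one further averaging passes to
pairs. -/
theorem BoundsInv.le_value (hM : M.OnlyTrivialECs zero one) {U L : S → A → ℝ}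
    (h : BoundsInv M zero one U L) {s : S} {a : A} (ha : a ∈ M.E s) :
    L s a ≤ M.value {one} s a := by
  refine (h.sub s a ha).trans (PMF.sum_toReal_mul_mono _ fun s' => ?_)
  refine hM.le_stateValue_of_subsolution (maxE_le h.le_zero) (maxE_le h.le_one) (fun t => ?_) s'
  obtain ⟨b, hb, e⟩ := exists_maxE_eq (M := M) L t
  exact ⟨b, hb, e.trans_le (h.sub t b hb)⟩

theorem BoundsInv.value_le (hM : M.OnlyTrivialECs zero one) {U L : S → A → ℝ}
    (h : BoundsInv M zero one U L) {s : S} {a : A} (ha : a ∈ M.E s) :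
    M.value {one} s a ≤ U s a := by
  refine le_trans (PMF.sum_toReal_mul_mono _ fun s' => ?_) (h.super s a ha)
  refine stateValue_le_of_supersolution hM.terminal_one (fun t => ?_) ?_ (fun t b hb => ?_) s'
  · obtain ⟨b, hb, e⟩ := exists_maxE_eq (M := M) U t
    exact e ▸ h.nonneg t b hb
  · obtain ⟨b, hb, e⟩ := exists_maxE_eq (M := M) U one
    exact e ▸ h.one_le b hb
  · exact (h.super t b hb).trans (le_maxE U hb)

/-- The successors of a configuration in the exploration phase. -/
theorem mem_support_exploreStep {c c' : Config S A} (hc : c.phase = .explore)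
    (h : c' ∈ (step M zero one quit c).support) :
    ∃ a ∈ M.argmaxE c.U c.path.last, ∃ s, 0 < M.Δ c.path.last a s ∧
      c'.path = c.path.snoc a s ∧ c'.U = c.U ∧ c'.L = c.L ∧ c'.iter = c.iter ∧
      (s = one ∨ s = zero → c'.phase = .update) ∧
      (¬ (s = one ∨ s = zero) → c'.phase = .explore) := by
  simp only [step, hc, exploreStep] at h
  rw [PMF.mem_support_bind_iff] at h
  obtain ⟨a, ha, h⟩ := h
  rw [PMF.mem_support_map_iff] at h
  obtain ⟨s, hs, rfl⟩ := h
  rw [PMF.mem_support_uniformOfFinset_iff] at ha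
  exact ⟨a, ha, s, pos_iff_ne_zero.mpr ((PMF.mem_support_iff _ _).mp hs), rfl, rfl, rfl, rfl,
    fun h => if_pos h, fun h => if_neg h⟩

/-- The successor of a configuration in the update phase. -/
theorem mem_support_updateStep {c c' : Config S A} (hc : c.phase = .update)
    {ω : FinPath S A} {a : A} {s : S} (hω : c.path = ω.snoc a s)
    (h : c' ∈ (step M zero one quit c).support) :
    c'.path = ω ∧ c'.U = backup M c.U ω.last a ∧ c'.L = backup M c.L ω.last a ∧
      (∀ t, ω = .start t → (c'.phase = .explore ∧ ¬ quit c'.U c'.L ∨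
        c'.phase = .halted ∧ quit c'.U c'.L) ∧ c'.iter = c.iter + 1) ∧
      (∀ ω' b t, ω = .snoc ω' b t → c'.phase = .update ∧ c'.iter = c.iter) := by
  obtain ⟨ph, p, U, L, it⟩ := c
  obtain rfl : ph = .update := hc
  obtain rfl : p = ω.snoc a s := hω
  simp only [step] at h
  rw [PMF.support_pure, Set.mem_singleton_iff] at h
  subst h
  cases ω with
  | start t =>
    refine ⟨rfl, rfl, rfl, fun t' _ => ⟨?_, rfl⟩, fun _ _ _ h => by cases h⟩
    by_cases hq : quit (backup M U (FinPath.start (A := A) t).last a)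
        (backup M L (FinPath.start (A := A) t).last a)
    · exact Or.inr ⟨if_pos hq, hq⟩
    · exact Or.inl ⟨if_neg hq, hq⟩
  | snoc ω' b t => exact ⟨rfl, rfl, rfl, (fun _ h => by cases h), fun _ _ _ _ => ⟨rfl, rfl⟩⟩

theorem mem_support_halted {c c' : Config S A} (hc : c.phase = .halted)
    (h : c' ∈ (step M zero one quit c).support) : c' = c := by
  simp only [step, hc] at h
  rwa [PMF.support_pure, Set.mem_singleton_iff] at h

end BRTDP

/-! ### Invariants of phase and path, and monotonicity of the bounds -/

/-- The first state of a finite sequence. -/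
def FinPath.root {S A : Type*} : FinPath S A → S
  | start s => s
  | snoc ω _ _ => ω.root

namespace BRTDP

open MDP
open scoped ENNReal

variable {S A : Type*} [Fintype S] {M : MDP S A} {zero one : S}
  {quit : (S → A → ℝ) → (S → A → ℝ) → Prop} {ρ : ℕ → Config S A}

/-- The properties of phase and path that are preserved by the algorithm. -/
structure PathInv (M : MDP S A) (zero one : S) (quit : (S → A → ℝ) → (S → A → ℝ) → Prop)
    (c : Config S A) : Prop where
  root : c.path.root = M.init
  snoc_of_update : c.phase = .update → ∃ ω a s, c.path = .snoc ω a s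
  not_terminal : c.phase = .explore → ∀ ω a s, c.path = .snoc ω a s → ¬ (s = one ∨ s = zero)
  quit_of_halted : c.phase = .halted → quit c.U c.L
  -- The initial configuration is excepted: the stopping condition is tested only when an iteration
  -- is completed.
  not_quit : c.phase = .explore → 0 < c.iter → ∀ s, c.path = .start s → ¬ quit c.U c.L

theorem PathInv.step {c c' : Config S A} (hc : PathInv M zero one quit c)
    (h : c' ∈ (step M zero one quit c).support) : PathInv M zero one quit c' := by
  cases hp : c.phase with
  | explore =>
    obtain ⟨a, _, s, _, hpath, _, _, _, h1, h2⟩ := mem_support_exploreStep hp h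
    refine ⟨?_, fun _ => ⟨_, _, _, hpath⟩, fun he ω b t hω hor => ?_, fun hh => ?_,
      fun _ _ t ht => ?_⟩
    · rw [hpath]; exact hc.root
    · rw [hpath] at hω
      cases hω
      rw [h1 hor] at he
      cases he
    · by_cases hor : s = one ∨ s = zero
      · rw [h1 hor] at hh; cases hh
      · rw [h2 hor] at hh; cases hh
    · rw [hpath] at ht; cases ht
  | update =>
    obtain ⟨ω, a, s, hω⟩ := hc.snoc_of_update hp
    obtain ⟨hpath, _, _, h1, h2⟩ := mem_support_updateStep hp hω h
    have hroot := hc.root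
    rw [hω] at hroot
    cases ω with
    | start t =>
      refine ⟨by rw [hpath]; exact hroot, fun hu => ?_, fun _ ω b t hω => ?_, fun hh => ?_,
        fun he _ _ _ => ?_⟩
      · rcases (h1 t rfl).1 with ⟨h, _⟩ | ⟨h, _⟩ <;> rw [h] at hu <;> cases hu
      · rw [hpath] at hω; cases hω
      · rcases (h1 t rfl).1 with ⟨h, _⟩ | ⟨_, h⟩
        · rw [h] at hh; cases hh
        · exact h
      · rcases (h1 t rfl).1 with ⟨_, h⟩ | ⟨h, _⟩
        · exact h
        · rw [h] at he; cases he
    | snoc ω' b t =>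
      have hph := (h2 ω' b t rfl).1
      refine ⟨by rw [hpath]; exact hroot, fun hu => ⟨_, _, _, hpath⟩, fun he => ?_, fun he => ?_,
        fun he => ?_⟩
        <;> rw [hph] at he <;> cases he
  | halted =>
    rw [mem_support_halted hp h]
    exact hc

theorem IsComputation.pathInv (hρ : IsComputation M zero one quit ρ) (n : ℕ) :
    PathInv M zero one quit (ρ n) := by
  induction n with
  | zero =>
    rw [hρ.1]
    refine ⟨rfl, fun h => ?_, fun _ ω a s h => ?_, fun h => ?_, fun _ h => ?_⟩ <;> simp [initial] at h
  | succ n ih => exact ih.step (hρ.2 n)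

/-- In each step, the bounds either do not change or are backed up at some pair of state and
action. -/
theorem IsComputation.bounds_succ (hρ : IsComputation M zero one quit ρ) (n : ℕ) :
    ((ρ (n + 1)).U = (ρ n).U ∧ (ρ (n + 1)).L = (ρ n).L) ∨
      ∃ s a, (ρ (n + 1)).U = backup M (ρ n).U s a ∧ (ρ (n + 1)).L = backup M (ρ n).L s a := by
  cases hp : (ρ n).phase with
  | explore =>
    obtain ⟨a, _, s, _, _, hU, hL, _⟩ := mem_support_exploreStep hp (hρ.2 n)
    exact Or.inl ⟨hU, hL⟩
  | update =>
    obtain ⟨ω, a, s, hω⟩ := (hρ.pathInv n).snoc_of_update hp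
    obtain ⟨_, hU, hL, _⟩ := mem_support_updateStep hp hω (hρ.2 n)
    exact Or.inr ⟨_, _, hU, hL⟩
  | halted =>
    rw [mem_support_halted hp (hρ.2 n)]
    exact Or.inl ⟨rfl, rfl⟩

theorem IsComputation.boundsInv (hM : M.OnlyTrivialECs zero one)
    (hρ : IsComputation M zero one quit ρ) (n : ℕ) :
    BoundsInv M zero one (ρ n).U (ρ n).L := by
  induction n with
  | zero => rw [hρ.1]; exact boundsInv_initial hM
  | succ n ih =>
    rcases hρ.bounds_succ n with ⟨hU, hL⟩ | ⟨s, a, hU, hL⟩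
    · rw [hU, hL]; exact ih
    · rw [hU, hL]; exact ih.backup hM s a

theorem IsComputation.antitone_U (hM : M.OnlyTrivialECs zero one)
    (hρ : IsComputation M zero one quit ρ) {s : S} {a : A} (ha : a ∈ M.E s) :
    Antitone fun n => (ρ n).U s a := by
  refine antitone_nat_of_succ_le fun n => ?_
  rcases hρ.bounds_succ n with ⟨hU, _⟩ | ⟨t, b, hU, _⟩
  · rw [hU]
  · rw [hU]; exact (hρ.boundsInv hM n).super.backup_le t b ha

theorem IsComputation.monotone_L (hM : M.OnlyTrivialECs zero one)
    (hρ : IsComputation M zero one quit ρ) {s : S} {a : A} (ha : a ∈ M.E s) :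
    Monotone fun n => (ρ n).L s a := by
  refine monotone_nat_of_le_succ fun n => ?_
  rcases hρ.bounds_succ n with ⟨_, hL⟩ | ⟨t, b, _, hL⟩
  · rw [hL]
  · rw [hL]; exact (hρ.boundsInv hM n).sub.le_backup t b ha

end BRTDP

/-! ### Fair computations and the end of explorations -/

theorem Filter.Frequently.exists_of_finite {α ι : Type*} [Finite ι] {l : Filter α}
    {p : α → ι → Prop} (h : ∃ᶠ x in l, ∃ i, p x i) : ∃ i, ∃ᶠ x in l, p x i := by
  by_contra! hn
  exact h ((eventually_all.mpr hn).mono fun x hx ⟨i, hi⟩ => hx i hi)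

/-- `p` is a prefix of `q`. -/
inductive FinPath.IsPrefix {S A : Type*} (p : FinPath S A) : FinPath S A → Prop where
  | refl : FinPath.IsPrefix p p
  | snoc {q : FinPath S A} (a : A) (s : S) : FinPath.IsPrefix p q →
      FinPath.IsPrefix p (FinPath.snoc q a s)

/-- The number of actions of a finite sequence. -/
def FinPath.length {S A : Type*} : FinPath S A → ℕ
  | start _ => 0
  | snoc ω _ _ => ω.length + 1

namespace BRTDP

open MDP
open scoped ENNReal

variable {S A : Type*}

/-- At time `n` the action `a` is taken in the state `s`. -/
def Draws (ρ : ℕ → Config S A) (s : S) (a : A) (n : ℕ) : Prop :=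
  ((ρ n).phase = .explore ∧ (ρ n).path.last = s) ∧ ∃ ω t, (ρ (n + 1)).path = .snoc ω a t

/-- At time `n` the action `a` is taken in the state `s`, leading to the state `t`. -/
def DrawsTo (ρ : ℕ → Config S A) (s : S) (a : A) (t : S) (n : ℕ) : Prop :=
  ((ρ n).phase = .explore ∧ (ρ n).path.last = s) ∧ ∃ ω, (ρ (n + 1)).path = .snoc ω a t

/-- Every successor of a pair of state and action that is drawn infinitely often occurs infinitely
often. -/
def Fair (M : MDP S A) (ρ : ℕ → Config S A) : Prop :=
  ∀ s a t, 0 < M.Δ s a t → (∃ᶠ n in atTop, Draws ρ s a n) → ∃ᶠ n in atTop, DrawsTo ρ s a t n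

/-- The states that are explored infinitely often. -/
def visited (ρ : ℕ → Config S A) : Set S :=
  {s | ∃ᶠ n in atTop, (ρ n).phase = .explore ∧ (ρ n).path.last = s}

variable [Fintype S] {M : MDP S A} {zero one : S}
  {quit : (S → A → ℝ) → (S → A → ℝ) → Prop} {ρ : ℕ → Config S A}

theorem fair_ae [Finite A] (M : MDP S A) (zero one : S)
    (quit : (S → A → ℝ) → (S → A → ℝ) → Prop) :
    ∀ᵐ ρ ∂(law M zero one quit), Fair M ρ := by
  simp only [Fair]
  refine ae_all_iff.mpr fun s => ae_all_iff.mpr fun a => ae_all_iff.mpr fun t => ?_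
  by_cases hpos : 0 < M.Δ s a t
  swap
  · exact ae_of_all _ fun _ h => absurd h hpos
  have key := chainLaw_fair (step M zero one quit) (initial M zero one)
    (G := {c | c.phase = .explore ∧ c.path.last = s})
    (H := {c | ∃ ω t, c.path = .snoc ω a t}) (H' := {c | ∃ ω, c.path = .snoc ω a t})
    (c := M.Δ s a t) hpos.ne' (fun c ⟨ω, h⟩ => ⟨ω, t, h⟩) ?_
  · filter_upwards [key] with ρ h _ hd using h hd
  rintro c ⟨hc, rfl⟩
  simp only [step, hc, exploreStep]
  rw [PMF.toMeasure_bind_apply _ _ _ MeasurableSet.of_discrete,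
    PMF.toMeasure_bind_apply _ _ _ MeasurableSet.of_discrete, ← ENNReal.tsum_mul_left]
  -- The inequality is checked for each drawn action `b`. For `b = a` the successor is `t` with
  -- probability `M.Δ s a t`; for other `b` the left side vanishes.
  refine ENNReal.tsum_le_tsum fun b => ?_
  rw [mul_left_comm]
  refine mul_le_mul_right ?_ _
  let _ : MeasurableSpace S := ⊤
  rw [PMF.toMeasure_map_apply _ _ _ (measurable_from_top) MeasurableSet.of_discrete,
    PMF.toMeasure_map_apply _ _ _ (measurable_from_top) MeasurableSet.of_discrete]
  by_cases hb : b = a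
  · subst hb
    calc _ ≤ M.Δ c.path.last b t * 1 := by gcongr; exact prob_le_one
      _ = (M.Δ c.path.last b).toMeasure {t} := by
        rw [mul_one, PMF.toMeasure_apply_singleton _ _ MeasurableSpace.measurableSet_top]
      _ ≤ _ := measure_mono (by rintro _ rfl; exact ⟨_, rfl⟩)
  · have : (fun s => ({ c with
        phase := open Classical in if s = one ∨ s = zero then .update else .explore
        path := c.path.snoc b s } : Config S A)) ⁻¹' {c | ∃ ω t, c.path = .snoc ω a t} = ∅ := by
      refine Set.eq_empty_of_forall_notMem ?_
      rintro s' ⟨ω, t, h⟩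
      cases h
      exact hb rfl
    erw [this]
    simp

theorem Draws.spec (hρ : IsComputation M zero one quit ρ) {s : S} {a : A} {n : ℕ}
    (h : Draws ρ s a n) : a ∈ M.argmaxE (ρ n).U s := by
  obtain ⟨⟨hp, rfl⟩, ω, t, hω⟩ := h
  obtain ⟨b, hb, s', _, hpath, _⟩ := mem_support_exploreStep hp (hρ.2 n)
  rw [hpath] at hω
  cases hω
  exact hb

/-- `Draws` leaves the old path unspecified, so that it imposes separate conditions on two
consecutive configurations, as `chainLaw_fair` demands; in a computation the path is recovered. -/
theorem Draws.exists_path (hρ : IsComputation M zero one quit ρ) {s : S} {a : A} {n : ℕ}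
    (h : Draws ρ s a n) : ∃ t, (ρ (n + 1)).path = (ρ n).path.snoc a t := by
  obtain ⟨⟨hp, rfl⟩, ω, t, hω⟩ := h
  obtain ⟨b, hb, s', _, hpath, _⟩ := mem_support_exploreStep hp (hρ.2 n)
  rw [hpath] at hω
  cases hω
  exact ⟨_, hpath⟩

/-- After a transition to `t`, either the update phase begins or `t` is explored. -/
theorem DrawsTo.next (hρ : IsComputation M zero one quit ρ) {s t : S} {a : A} {n : ℕ}
    (h : DrawsTo ρ s a t n) :
    ((t = zero ∨ t = one) ∧ (ρ (n + 1)).phase = .update) ∨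
      ((ρ (n + 1)).phase = .explore ∧ (ρ (n + 1)).path.last = t) := by
  obtain ⟨⟨hp, rfl⟩, ω, hω⟩ := h
  obtain ⟨b, hb, s', _, hpath, _, _, _, h1, h2⟩ := mem_support_exploreStep hp (hρ.2 n)
  rw [hpath] at hω
  cases hω
  by_cases ht : t = one ∨ t = zero
  · exact Or.inl ⟨ht.symm, h1 ht⟩
  · refine Or.inr ⟨h2 ht, ?_⟩
    rw [hpath]; rfl

theorem Fair.exists_draws [Finite A] (hf : Fair M ρ) (hρ : IsComputation M zero one quit ρ)
    {s : S} (hs : s ∈ visited ρ) :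
    ∃ a ∈ M.E s, (∃ᶠ n in atTop, Draws ρ s a n) ∧
      ∀ t, 0 < M.Δ s a t → ∃ᶠ n in atTop, DrawsTo ρ s a t n := by
  have h : ∃ᶠ n in atTop, ∃ a, Draws ρ s a n := by
    refine hs.mono ?_
    rintro n ⟨hp, rfl⟩
    obtain ⟨b, hb, s', _, hpath, _⟩ := mem_support_exploreStep hp (hρ.2 n)
    exact ⟨b, ⟨hp, rfl⟩, _, _, hpath⟩
  obtain ⟨a, ha⟩ := h.exists_of_finite
  obtain ⟨n, hn⟩ := ha.exists
  exact ⟨a, mem_E_of_mem_argmaxE (hn.spec hρ), ha, fun t ht => hf s a t ht ha⟩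

theorem frequently_next {p : ℕ → Prop} (h : ∃ᶠ n in atTop, p (n + 1)) : ∃ᶠ n in atTop, p n := by
  rw [frequently_atTop] at h ⊢
  intro N
  obtain ⟨n, hn, hp⟩ := h N
  exact ⟨n + 1, by omega, hp⟩

theorem mem_visited_of_drawsTo (hρ : IsComputation M zero one quit ρ) {s t : S} {a : A}
    (h : ∃ᶠ n in atTop, DrawsTo ρ s a t n) : t ∈ visited ρ ∨ t = zero ∨ t = one := by
  by_cases ht : t = zero ∨ t = one
  · exact Or.inr ht
  · refine Or.inl (frequently_next (h.mono fun n hn => ?_))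
    rcases hn.next hρ with h | h
    · exact absurd h.1 ht
    · exact h

/-- In a fair computation that is never halted, every exploration ends. -/
theorem Fair.frequently_update [Finite A] (hM : M.OnlyTrivialECs zero one) (hf : Fair M ρ)
    (hρ : IsComputation M zero one quit ρ) (hh : ∀ n, (ρ n).phase ≠ .halted) :
    ∃ᶠ n in atTop, (ρ n).phase = .update := by
  by_contra hn
  obtain ⟨N, hN⟩ := eventually_atTop.mp (not_frequently.mp hn)
  have hexp : ∀ n, N ≤ n → (ρ n).phase = .explore := by
    intro n hn
    cases hp : (ρ n).phase with
    | explore => rfl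
    | update => exact absurd hp (hN n hn)
    | halted => exact absurd hp (hh n)
  have hne : (visited ρ).Nonempty := by
    have : ∃ᶠ n in atTop, ∃ s, (ρ n).phase = .explore ∧ (ρ n).path.last = s :=
      Eventually.frequently (eventually_atTop.mpr ⟨N, fun n hn => ⟨_, hexp n hn, rfl⟩⟩)
    exact this.exists_of_finite
  have hcl : ∀ s ∈ visited ρ, ∃ a ∈ M.E s, ∀ t, 0 < M.Δ s a t → t ∈ visited ρ := by
    intro s hs
    obtain ⟨a, ha, _, h⟩ := hf.exists_draws hρ hs
    refine ⟨a, ha, fun t ht => frequently_next ?_⟩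
    refine ((h t ht).and_eventually (eventually_ge_atTop N)).mono fun n ⟨hn, hNn⟩ => ?_
    rcases hn.next hρ with h | h
    · exact absurd h.2 (hN _ (by omega))
    · exact h
  have hnt : ∀ s ∈ visited ρ, ¬ (s = one ∨ s = zero) := by
    intro s hs
    -- The bound `N + 1` puts the predecessor in the exploration too, so the path has made a step;
    -- the initial state alone might be terminal.
    obtain ⟨n, hn, hp, hl⟩ := frequently_atTop.mp hs (N + 1)
    obtain ⟨n, rfl⟩ : ∃ m, n = m + 1 := ⟨n - 1, by omega⟩
    obtain ⟨b, hb, s', _, hpath, _⟩ := mem_support_exploreStep (hexp n (by omega)) (hρ.2 n)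
    have := (hρ.pathInv (n + 1)).not_terminal hp _ _ _ hpath
    rw [hpath] at hl
    rwa [← hl]
  rcases hM.mem_of_closed hne hcl with h | h
  · exact hnt _ h (Or.inr rfl)
  · exact hnt _ h (Or.inl rfl)

/-! ### Completion of iterations and backup of the drawn pairs -/

/-- At time `n` an iteration is completed, and the next one begins at time `n + 1`. -/
def Completes (M : MDP S A) (ρ : ℕ → Config S A) (n : ℕ) : Prop :=
  (ρ (n + 1)).iter = (ρ n).iter + 1 ∧ (ρ (n + 1)).phase = .explore ∧
    (ρ (n + 1)).path = .start M.init

/-- Each update step shortens the path, whose length is the induction parameter. -/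
theorem exists_completes (hρ : IsComputation M zero one quit ρ)
    (hh : ∀ n, (ρ n).phase ≠ .halted) {n : ℕ} (hn : (ρ n).phase = .update) :
    ∃ m, n ≤ m ∧ Completes M ρ m := by
  induction hk : (ρ n).path.length using Nat.strong_induction_on generalizing n with
  | _ k ih =>
    obtain ⟨ω, a, s, hω⟩ := (hρ.pathInv n).snoc_of_update hn
    obtain ⟨hpath, _, _, h1, h2⟩ := mem_support_updateStep hn hω (hρ.2 n)
    cases ω with
    | start t =>
      obtain ⟨h3, h4⟩ := h1 t rfl
      have hr := (hρ.pathInv n).root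
      rw [hω] at hr
      refine ⟨n, le_rfl, h4, ?_, ?_⟩
      · rcases h3 with h | h
        · exact h.1
        · exact absurd h.1 (hh _)
      · rw [hpath]; exact congrArg _ hr
    | snoc ω' b t =>
      obtain ⟨m, hm, hc⟩ := ih (ρ (n + 1)).path.length
        (by rw [← hk, hω, hpath]; exact Nat.lt_succ_self _) (h2 ω' b t rfl).1 rfl
      exact ⟨m, by omega, hc⟩

theorem Fair.frequently_completes [Finite A] (hM : M.OnlyTrivialECs zero one) (hf : Fair M ρ)
    (hρ : IsComputation M zero one quit ρ) (hh : ∀ n, (ρ n).phase ≠ .halted) :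
    ∃ᶠ n in atTop, Completes M ρ n := by
  rw [frequently_atTop]
  intro N
  obtain ⟨n, hn, hu⟩ := frequently_atTop.mp (hf.frequently_update hM hρ hh) N
  obtain ⟨m, hm, hc⟩ := exists_completes hρ hh hu
  exact ⟨m, hn.trans hm, hc⟩

theorem IsComputation.iter_succ (hρ : IsComputation M zero one quit ρ) (n : ℕ) :
    (ρ n).iter ≤ (ρ (n + 1)).iter ∧ (ρ (n + 1)).iter ≤ (ρ n).iter + 1 := by
  cases hp : (ρ n).phase with
  | explore =>
    obtain ⟨a, _, s, _, _, _, _, hi, _⟩ := mem_support_exploreStep hp (hρ.2 n)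
    omega
  | update =>
    obtain ⟨ω, a, s, hω⟩ := (hρ.pathInv n).snoc_of_update hp
    obtain ⟨_, _, _, h1, h2⟩ := mem_support_updateStep hp hω (hρ.2 n)
    cases ω with
    | start t => have := (h1 t rfl).2; omega
    | snoc ω' b t => have := (h2 ω' b t rfl).2; omega
  | halted =>
    rw [mem_support_halted hp (hρ.2 n)]
    omega

theorem IsComputation.monotone_iter (hρ : IsComputation M zero one quit ρ) :
    Monotone fun n => (ρ n).iter :=
  monotone_nat_of_le_succ fun n => (hρ.iter_succ n).1

theorem IsComputation.iter_le (hρ : IsComputation M zero one quit ρ) (n : ℕ) :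
    (ρ n).iter ≤ n := by
  induction n with
  | zero => rw [hρ.1]; rfl
  | succ n ih => have := (hρ.iter_succ n).2; omega

/-- The counter starts at 0, is unbounded and grows by at most one per step, so it skips no value.
-/
theorem IsComputation.exists_iter_eq (hρ : IsComputation M zero one quit ρ)
    (h : ∃ᶠ n in atTop, Completes M ρ n) (i : ℕ) : ∃ n, (ρ n).iter = i := by
  induction i with
  | zero => exact ⟨0, by rw [hρ.1]; rfl⟩
  | succ i ih =>
    obtain ⟨n, hn⟩ := ih
    obtain ⟨m, hm, hc, _⟩ := frequently_atTop.mp h n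
    have hge : (ρ n).iter ≤ (ρ m).iter := hρ.monotone_iter hm
    have hex : ∃ k, i + 1 ≤ (ρ k).iter := ⟨m + 1, by omega⟩
    classical
    have h1 := Nat.find_spec hex
    have h2 := fun {k} => Nat.find_min hex (m := k)
    generalize Nat.find hex = k at h1 h2
    cases k with
    | zero => have := hρ.iter_le 0; omega
    | succ k =>
      have h3 := h2 (Nat.lt_succ_self k)
      have h4 := (hρ.iter_succ k).2
      exact ⟨k + 1, by omega⟩

/-- A pair of state and action that is drawn is updated before the iteration is completed. -/
theorem Draws.exists_backup (hρ : IsComputation M zero one quit ρ)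
    (hc : ∃ᶠ n in atTop, Completes M ρ n) {s : S} {a : A} {n : ℕ} (h : Draws ρ s a n) :
    ∃ m, n ≤ m ∧ (ρ (m + 1)).U = backup M (ρ m).U s a ∧
      (ρ (m + 1)).L = backup M (ρ m).L s a := by
  by_contra! hn
  obtain ⟨t, hpath⟩ := h.exists_path hρ
  -- The extended path could stop being a prefix only through removal of its last action, which
  -- backs up the pair. A completed iteration leaves a path without actions, a contradiction.
  have hpre : ∀ m, n + 1 ≤ m → FinPath.IsPrefix ((ρ n).path.snoc a t) (ρ m).path := by
    intro m hm
    induction m, hm using Nat.le_induction with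
    | base => rw [hpath]; exact .refl
    | succ m hm ih =>
      cases hp : (ρ m).phase with
      | explore =>
        obtain ⟨b, _, s', _, hpath', _⟩ := mem_support_exploreStep hp (hρ.2 m)
        rw [hpath']
        exact .snoc _ _ ih
      | update =>
        obtain ⟨ω, b, u, hω⟩ := (hρ.pathInv m).snoc_of_update hp
        obtain ⟨hpath', hU, hL, _⟩ := mem_support_updateStep hp hω (hρ.2 m)
        rw [hω] at ih
        rw [hpath']
        cases ih with
        | refl =>
          rw [h.1.2] at hU hL
          exact absurd hL (hn m (by omega) hU)
        | snoc _ _ ih => exact ih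
      | halted =>
        rw [mem_support_halted hp (hρ.2 m)]
        exact ih
  obtain ⟨m, hm, _, _, hs⟩ := frequently_atTop.mp hc n
  have := hpre (m + 1) (by omega)
  rw [hs] at this
  cases this

/-! ### Convergence of the bounds at the initial state, and termination -/

/-- In a fair computation that is never halted, the bounds at the initial state converge to each
other. -/
theorem Fair.tendsto_gap [Finite A] (hM : M.OnlyTrivialECs zero one) (hf : Fair M ρ)
    (hρ : IsComputation M zero one quit ρ) (hh : ∀ n, (ρ n).phase ≠ .halted) :
    Tendsto (fun n => M.maxE (ρ n).U M.init - M.maxE (ρ n).L M.init) atTop (𝓝 0) := by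
  have hc := hf.frequently_completes hM hρ hh
  -- With the implication inside the existential, `choose` yields a total function whose values at
  -- disabled actions are irrelevant.
  have hU : ∀ s a, ∃ x, a ∈ M.E s → Tendsto (fun n => (ρ n).U s a) atTop (𝓝 x) := fun s a =>
    ⟨⨅ n, (ρ n).U s a, fun ha => tendsto_atTop_ciInf (hρ.antitone_U hM ha)
      ⟨M.value {one} s a, by rintro _ ⟨n, rfl⟩; exact (hρ.boundsInv hM n).value_le hM ha⟩⟩
  have hL : ∀ s a, ∃ x, a ∈ M.E s → Tendsto (fun n => (ρ n).L s a) atTop (𝓝 x) := fun s a =>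
    ⟨⨆ n, (ρ n).L s a, fun ha => tendsto_atTop_ciSup (hρ.monotone_L hM ha)
      ⟨M.value {one} s a, by rintro _ ⟨n, rfl⟩; exact (hρ.boundsInv hM n).le_value hM ha⟩⟩
  choose u hu using hU
  choose l hl using hL
  have humax : ∀ s, Tendsto (fun n => M.maxE (ρ n).U s) atTop (𝓝 (M.maxE u s)) :=
    fun s => tendsto_maxE (W := fun n => (ρ n).U) fun a ha => hu s a ha
  have hlmax : ∀ s, Tendsto (fun n => M.maxE (ρ n).L s) atTop (𝓝 (M.maxE l s)) :=
    fun s => tendsto_maxE (W := fun n => (ρ n).L) fun a ha => hl s a ha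
  have hle : ∀ n s, M.maxE (ρ n).L s ≤ M.maxE (ρ n).U s := fun n s => maxE_mono fun a ha =>
    ((hρ.boundsInv hM n).le_value hM ha).trans ((hρ.boundsInv hM n).value_le hM ha)
  have hinit : M.init ∈ visited ρ := by
    refine frequently_next (hc.mono fun n hn => ⟨hn.2.1, ?_⟩)
    rw [hn.2.2]; rfl
  have hupd : ∀ s a, (∃ᶠ n in atTop, Draws ρ s a n) → ∃ᶠ n in atTop,
      (ρ (n + 1)).U = backup M (ρ n).U s a ∧ (ρ (n + 1)).L = backup M (ρ n).L s a := by
    intro s a h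
    rw [frequently_atTop] at h ⊢
    intro N
    obtain ⟨n, hn, hd⟩ := h N
    obtain ⟨m, hm, h⟩ := hd.exists_backup hρ hc
    exact ⟨m, hn.trans hm, h⟩
  have h0 : M.maxE (initial M zero one).U zero = 0 :=
    maxE_eq_of_forall_eq fun a _ => by simp [initial]
  have h1 : M.maxE (initial M zero one).U one = 1 :=
    maxE_eq_of_forall_eq fun a _ => by simp [initial, hM.ne.symm]
  have h0' : M.maxE (initial M zero one).L zero = 0 :=
    maxE_eq_of_forall_eq fun a _ => by simp [initial, hM.ne]
  have h1' : M.maxE (initial M zero one).L one = 1 :=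
    maxE_eq_of_forall_eq fun a _ => by simp [initial]
  have hanti : ∀ s, M.maxE u s ≤ M.maxE (initial M zero one).U s := fun s =>
    le_of_tendsto' (humax s) fun n => maxE_mono fun a ha => by
      rw [← hρ.1]; exact hρ.antitone_U hM ha (Nat.zero_le n)
  have hmono : ∀ s, M.maxE (initial M zero one).L s ≤ M.maxE l s := fun s =>
    ge_of_tendsto' (hlmax s) fun n => maxE_mono fun a ha => by
      rw [← hρ.1]; exact hρ.monotone_L hM ha (Nat.zero_le n)
  have hgap : M.maxE u M.init - M.maxE l M.init ≤ 0 := by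
    refine hM.nonpos_of_le_sum (T := visited ρ) (f := fun s => M.maxE u s - M.maxE l s)
      ?_ ?_ ?_ _ hinit
    · linarith [hanti zero, hmono zero]
    · linarith [hanti one, hmono one]
    · intro s hs _ _
      obtain ⟨a, ha, hd, hto⟩ := hf.exists_draws hρ hs
      refine ⟨a, ha, fun t ht => mem_visited_of_drawsTo hρ (hto t ht), ?_⟩
      -- Equalities that hold infinitely often pass to the limits: `a` maximises `U` whenever it is
      -- drawn (`e1`), and a backup at `(s, a)` equates its bounds with the averages (`e2`, `e3`).
      have e1 : M.maxE u s = u s a := tendsto_nhds_unique_of_frequently_eq (humax s) (hu s a ha)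
        (hd.mono fun n hn => maxE_eq_of_mem_argmaxE (hn.spec hρ))
      have hsum : ∀ {W : ℕ → S → A → ℝ} {w : S → A → ℝ},
          (∀ s, Tendsto (fun n => M.maxE (W n) s) atTop (𝓝 (M.maxE w s))) →
          Tendsto (fun n => ∑ t, (M.Δ s a t).toReal * M.maxE (W n) t) atTop
            (𝓝 (∑ t, (M.Δ s a t).toReal * M.maxE w t)) := fun h =>
        tendsto_finsetSum _ fun t _ => (h t).const_mul _
      have e2 : u s a = ∑ t, (M.Δ s a t).toReal * M.maxE u t :=
        tendsto_nhds_unique_of_frequently_eq ((tendsto_add_atTop_iff_nat 1).mpr (hu s a ha))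
          (hsum (W := fun n => (ρ n).U) humax)
          ((hupd s a hd).mono fun n hn => by rw [hn.1, backup_self])
      have e3 : l s a = ∑ t, (M.Δ s a t).toReal * M.maxE l t :=
        tendsto_nhds_unique_of_frequently_eq ((tendsto_add_atTop_iff_nat 1).mpr (hl s a ha))
          (hsum (W := fun n => (ρ n).L) hlmax)
          ((hupd s a hd).mono fun n hn => by rw [hn.2, backup_self])
      simp only [mul_sub, Finset.sum_sub_distrib]
      rw [← e2, ← e3, e1]
      -- For `l` no maximality of `a` is needed: replacing `M.maxE l s` by the smaller `l s a` only
      -- enlarges the gap.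
      linarith [le_maxE (M := M) l ha]
  have hlim := (humax M.init).sub (hlmax M.init)
  have hge : 0 ≤ M.maxE u M.init - M.maxE l M.init :=
    ge_of_tendsto' hlim fun n => sub_nonneg.mpr (hle n M.init)
  rwa [le_antisymm hgap hge] at hlim

theorem isComputation_ae (M : MDP S A) (zero one : S)
    (quit : (S → A → ℝ) → (S → A → ℝ) → Prop) :
    ∀ᵐ ρ ∂(law M zero one quit), IsComputation M zero one quit ρ :=
  chainLaw_mem_support _ _

theorem IsComputation.not_halted (hρ : IsComputation M zero one never ρ) (n : ℕ) :
    (ρ n).phase ≠ .halted := fun h => (hρ.pathInv n).quit_of_halted h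

/-- Otherwise the gap tends to 0, yet `PathInv.not_quit` keeps it at least `ε` after each of
infinitely many completed iterations. -/
theorem IsComputation.exists_halted [Finite A] (hM : M.OnlyTrivialECs zero one) {ε : ℝ}
    (hε : 0 < ε) (hρ : IsComputation M zero one (precise M ε) ρ) (hf : Fair M ρ) :
    ∃ n, (ρ n).phase = .halted := by
  by_contra! hh
  obtain ⟨N, hN⟩ := eventually_atTop.mp ((hf.tendsto_gap hM hρ hh).eventually_lt_const hε)
  obtain ⟨n, hn, hu⟩ := frequently_atTop.mp (hf.frequently_completes hM hρ hh) N
  refine (hρ.pathInv (n + 1)).not_quit hu.2.1 (by have := hu.1; omega) _ hu.2.2 ?_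
  exact hN (n + 1) (by omega)

end BRTDP

theorem mainTheorem3 {S A : Type*} [Fintype S] [Finite A] (M : MDP S A) (zero one : S)
    (hM : M.OnlyTrivialECs zero one) :
    -- for every precision, the algorithm almost surely terminates, with correct bounds
    (∀ ε : ℝ, 0 < ε → ∀ᵐ ρ ∂(BRTDP.law M zero one (BRTDP.precise M ε)),
      ∃ n, (ρ n).phase = BRTDP.Phase.halted ∧
        M.maxE (ρ n).U M.init - M.maxE (ρ n).L M.init < ε ∧
        ∀ a ∈ M.E M.init, (ρ n).L M.init a ≤ M.value {one} M.init a ∧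
          M.value {one} M.init a ≤ (ρ n).U M.init a) ∧
    -- in every computation, at every time, the bounds are monotone and correct
    (∀ quit ρ, BRTDP.IsComputation M zero one quit ρ → ∀ s, ∀ a ∈ M.E s,
      (∀ m n, m ≤ n → (ρ n).U s a ≤ (ρ m).U s a ∧ (ρ m).L s a ≤ (ρ n).L s a) ∧
      ∀ n, (ρ n).L s a ≤ M.value {one} s a ∧ M.value {one} s a ≤ (ρ n).U s a) ∧
    -- if the outer loop is never left, then almost surely all iterations are completed, the bounds
    -- after the iterations are monotone and correct, and their gap at the initial state tends to 0
    (∀ᵐ ρ ∂(BRTDP.law M zero one BRTDP.never),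
      (∀ i, ∃ n, (ρ n).iter = i) ∧
      (∀ i j, i ≤ j → ∀ s, ∀ a ∈ M.E s,
        (BRTDP.afterIter ρ j).U s a ≤ (BRTDP.afterIter ρ i).U s a ∧
        M.value {one} s a ≤ (BRTDP.afterIter ρ j).U s a ∧
        (BRTDP.afterIter ρ j).L s a ≤ M.value {one} s a ∧
        (BRTDP.afterIter ρ i).L s a ≤ (BRTDP.afterIter ρ j).L s a) ∧
      Tendsto (fun i => M.maxE (BRTDP.afterIter ρ i).U M.init -
        M.maxE (BRTDP.afterIter ρ i).L M.init) atTop (𝓝 0)) := by 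
  refine ⟨fun ε hε => ?_, fun quit ρ hρ s a ha => ?_, ?_⟩
  · filter_upwards [BRTDP.isComputation_ae M zero one (BRTDP.precise M ε),
      BRTDP.fair_ae M zero one (BRTDP.precise M ε)] with ρ hρ hf
    obtain ⟨n, hn⟩ := hρ.exists_halted hM hε hf
    exact ⟨n, hn, (hρ.pathInv n).quit_of_halted hn, fun a ha =>
      ⟨(hρ.boundsInv hM n).le_value hM ha, (hρ.boundsInv hM n).value_le hM ha⟩⟩
  · exact ⟨fun m n hmn => ⟨hρ.antitone_U hM ha hmn, hρ.monotone_L hM ha hmn⟩,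
      fun n => ⟨(hρ.boundsInv hM n).le_value hM ha, (hρ.boundsInv hM n).value_le hM ha⟩⟩
  · filter_upwards [BRTDP.isComputation_ae M zero one BRTDP.never,
      BRTDP.fair_ae M zero one BRTDP.never] with ρ hρ hf
    have hc := hf.frequently_completes hM hρ hρ.not_halted
    have hex := hρ.exists_iter_eq hc
    -- Completion of every iteration makes these sets nonempty, which excludes the default value 0
    -- of `sInf`.
    have hmem : ∀ i, (ρ (sInf {n | (ρ n).iter = i})).iter = i := fun i =>
      Nat.sInf_mem (s := {n | (ρ n).iter = i}) (hex i)
    have hmono : ∀ i j, i ≤ j → sInf {n | (ρ n).iter = i} ≤ sInf {n | (ρ n).iter = j} := by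
      intro i j hij
      rcases hij.eq_or_lt with rfl | hlt
      · exact le_rfl
      · refine (hρ.monotone_iter.reflect_lt ?_).le
        simp only [hmem]
        exact hlt
    refine ⟨hex, fun i j hij s a ha => ⟨hρ.antitone_U hM ha (hmono i j hij),
      (hρ.boundsInv hM _).value_le hM ha, (hρ.boundsInv hM _).le_value hM ha,
      hρ.monotone_L hM ha (hmono i j hij)⟩, ?_⟩
    -- The counter is at most the time, so the `i`-th iteration ends no earlier than time `i`, and
    -- the limit in time gives the limit in iterations.
    refine (hf.tendsto_gap hM hρ hρ.not_halted).comp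
      (tendsto_atTop_mono (fun i => ?_) tendsto_id)
    have := hρ.iter_le (sInf {n | (ρ n).iter = i})
    rwa [hmem] at this
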